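/- For positive integers $n,m,k$ write $N=\binom n2$. Let $\mathbb P_0$ be the law of $G(n,m)$, the uniform distribution over all graphs on $[n]$ with exactly $m$ edges. Let $\mathbb P_1$ be the planted star model (for $k\le n-1$ and $k\le m\le N$): choose a hub $v_*\in[n]$ uniformly at random, choose $k$ of the $n-1$ possible edges at $v_*$ uniformly at random, and then add $m-k$ edges chosen uniformly at random from the remaining $N-k$ possible edges. Let $\Delta$ be the maximum degree of the graph, let $d_{v_*}$ be the degree of $v_*$ in it, and for fixed $\alpha>0$ let $$t^*=t^*_\alpha(n,m)=\frac{2m}{n}+\sqrt{\frac{2m}{n}\Big(1-\frac mN\Big)}\,\sqrt{2\log n-\frac1\alpha\log\log n}.$$ Let $n\to\infty$, and let $m=m(n)$ satisfy $n(\log n)^3\ll m\ll n^2$. 1. If $\alpha>1$ and $k=k(n)$ satisfies $(\log n)^2\ll k\ll\sqrt n$, then $$\mathbb P_0(\Delta\ge t^*)=o(1)\qquad\text{and}\qquad \mathbb P_1(\Delta\ge t^*)=\mathbb P_1(d_{v_*}\ge t^*)+o(1).$$ (In particular this holds whenever $m=(c+o(1))\,k^2n/\log n$ for a constant $c>0$,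 since then $n(\log n)^3\ll m\ll n^2$.) 2. $\mathbb P_0(\Delta\ge t^*)\to0$ if $\alpha>1$, and $\mathbb P_0(\Delta\ge t^*)\to1$ if $0<\alpha<1$. -/

import Mathlib

open Filter Topology Asymptotics Finset
open scoped BigOperators

/-- The probability, when `G` is drawn from the Erdős–Rényi model `G(n, m)` (uniform over all
simple graphs on `n` labelled vertices with exactly `m` edges), that `G` has the property `A`.
Here `𝔼` is the average over a finite set. -/
noncomputable def nullProb (n m : ℕ) (A : SimpleGraph (Fin n) → Prop) : ℝ :=
  open Classical in
  𝔼 G ∈ {G : SimpleGraph (Fin n) | #G.edgeFinset = m}, if A G then (1 : ℝ) else 0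

/-- The probability, in the planted star model, of a property `A` of the pair (hub, graph).
The hub `v` is uniform over the vertices; `S` is a uniform set of `k` of the `n - 1` possible
edges at `v`; `H` is a uniform set of `m - k` of the possible edges not in `S`; the graph has
edge set `S ∪ H`. The model is meaningful for `k ≤ n - 1` and `k ≤ m ≤ n.choose 2`. -/
noncomputable def plantedProb (n m k : ℕ) (A : Fin n → SimpleGraph (Fin n) → Prop) : ℝ :=
  open Classical in
  𝔼 v : Fin n,
    𝔼 S ∈ ((⊤ : SimpleGraph (Fin n)).incidenceFinset v).powersetCard k,
      𝔼 H ∈ ((⊤ : SimpleGraph (Fin n)).edgeFinset \ S).powersetCard (m - k),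
        if A v (SimpleGraph.fromEdgeSet (↑(S ∪ H) : Set (Sym2 (Fin n)))) then (1 : ℝ) else 0

/-- The degree of the vertex `v` in `G`. -/
noncomputable def vertexDegree {n : ℕ} (G : SimpleGraph (Fin n)) (v : Fin n) : ℕ :=
  open Classical in G.degree v

/-- The maximum degree of `G`. -/
noncomputable def maxDegree {n : ℕ} (G : SimpleGraph (Fin n)) : ℕ :=
  open Classical in G.maxDegree

/-- The threshold
`t* = 2m/n + √((2m/n)(1 - m/N)) · √(2 log n - (1/α) log log n)` with `N = n.choose 2`. -/
noncomputable def degreeThreshold (α : ℝ) (n m : ℕ) : ℝ :=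
  2 * (m : ℝ) / n
    + √(2 * (m : ℝ) / n * (1 - (m : ℝ) / (n.choose 2 : ℝ)))
      * √(2 * Real.log n - 1 / α * Real.log (Real.log n))

/-- The star sizes considered: `(log n)² ≪ k ≪ √n`. -/
def StarSizeRegime (k : ℕ → ℕ) : Prop :=
  (fun n : ℕ => Real.log n ^ 2) =o[atTop] (fun n : ℕ => (k n : ℝ)) ∧
    (fun n : ℕ => (k n : ℝ)) =o[atTop] (fun n : ℕ => √(n : ℝ))

/-- The numbers of edges considered: `n (log n)³ ≪ m ≪ n²`. -/
def EdgeCountRegime (m : ℕ → ℕ) : Prop :=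
  (fun n : ℕ => (n : ℝ) * Real.log n ^ 3) =o[atTop] (fun n : ℕ => (m n : ℝ)) ∧
    (fun n : ℕ => (m n : ℝ)) =o[atTop] (fun n : ℕ => (n : ℝ) ^ 2)

/-!
Identify a graph with `m` edges with an `m`-subset `M` of the set of all `N = n.choose 2` possible
edges. The degree of a vertex is then the size of the intersection of `M` with a star of `n - 1`
edges, a hypergeometric variable with mean `μ = 2m/n`. With `σ² = μ (1 - m/N)`, the threshold is
`μ + σ x`, where `x² = 2 log n - (1/α) log log n`.

The point is that the probability `q` of a degree at least `μ + σ x` has the exact order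
`exp (-x²/2) / x`, including the factor `1/x` (`hypTail_le`, `le_hypTail`). Then `n q` has order
`(log n) ^ (1/(2α) - 1/2)`, which tends to `0` for `α > 1` and to infinity for `α < 1`. Both bounds
come from the ratio of consecutive hypergeometric weights, which at distance `y` from `μ` is
`exp (-y/σ²)` up to second-order errors (`hyp_succ_le_exp`, `hyp_succ_ge_exp`). Multiplied over a
range of `σ x` indices these errors amount to a factor `exp (O (x³/σ))`, which is bounded because
`m` exceeds `n (log n)³`. The product is anchored near the mean, where weights are at most of
order `1/σ` because they are monotone and sum to at most `1`, and where one of them is at least of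
order `1/σ` by Chebyshev's inequality. The tail beyond `μ + σ x` is comparable to `σ/x` times its
first weight.

For `α > 1` the null statement is a union bound. In the planted model, a vertex other than the hub
meets at most one edge of the star, and its other edges are dominated by those of `G(n, m)`,
because averages of monotone functions over slices of the Boolean lattice increase with the slice
(`sliceMean_sdiff_le`). Hence it exceeds the threshold with probability at most that of a degree
at least the threshold minus `1` in `G(n, m)`, and the union bound applies again
(`plantedProb_sub_mem`).

For `α < 1` the second moment method is used (`one_sub_nullProb_le_maxDegree_le`). Given whether
`uv` is an edge, the degrees of `u` and `v` are negatively correlated (`sliceMean_hits_mul_le`).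
The absence of `uv` only costs a factor `1/(1 - m/N)²`, and its presence, which has probability
`m/N → 0`, inflates the tail of each degree by at most a constant (`hypTail_le_mul_hypTail_succ`).
-/

/-! ### Averages over the subsets of a given size -/

section Slices

variable {ι : Type*}

/-- The average of `f` over the `m`-element subsets of `E`: the expectation of `f M` when `M` is a
uniformly random `m`-subset of `E`. -/
noncomputable def sliceMean (E : Finset ι) (m : ℕ) (f : Finset ι → ℝ) : ℝ :=
  𝔼 M ∈ E.powersetCard m, f M

lemma sliceMean_eq (E : Finset ι) (m : ℕ) (f : Finset ι → ℝ) :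
    sliceMean E m f = (∑ M ∈ E.powersetCard m, f M) / ((#E).choose m : ℝ) := by
  rw [sliceMean, expect_eq_sum_div_card, card_powersetCard]

lemma sum_powersetCard_eq (E : Finset ι) (m : ℕ) (f : Finset ι → ℝ) :
    ∑ M ∈ E.powersetCard m, f M = ((#E).choose m : ℝ) * sliceMean E m f := by
  rw [sliceMean, ← card_powersetCard, card_mul_expect]

lemma sliceMean_mono {E : Finset ι} {m : ℕ} {f g : Finset ι → ℝ}
    (h : ∀ M ∈ E.powersetCard m, f M ≤ g M) : sliceMean E m f ≤ sliceMean E m g :=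
  expect_le_expect h

lemma sliceMean_congr {E : Finset ι} {m : ℕ} {f g : Finset ι → ℝ}
    (h : ∀ M ∈ E.powersetCard m, f M = g M) : sliceMean E m f = sliceMean E m g :=
  expect_congr rfl h

lemma sliceMean_sum {κ : Type*} (s : Finset κ) (E : Finset ι) (m : ℕ)
    (f : κ → Finset ι → ℝ) :
    sliceMean E m (fun M => ∑ u ∈ s, f u M) = ∑ u ∈ s, sliceMean E m (f u) :=
  expect_sum_comm _ _ _

variable [DecidableEq ι]

/-- Double counting of the pairs `(M, e)` with `e ∈ M`, against the pairs `(M \ {e}, e)`. -/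
lemma sum_sum_erase (E : Finset ι) (j : ℕ) (g : Finset ι → ℝ) :
    ∑ M ∈ E.powersetCard (j + 1), ∑ e ∈ M, g (M.erase e)
      = ((#E : ℝ) - j) * ∑ H ∈ E.powersetCard j, g H := by
  have h : ∑ M ∈ E.powersetCard (j + 1), ∑ e ∈ M, g (M.erase e)
      = ∑ H ∈ E.powersetCard j, ∑ _e ∈ E \ H, g H := by
    rw [sum_sigma', sum_sigma']
    refine sum_bij' (fun x _ => ⟨x.1.erase x.2, x.2⟩) (fun x _ => ⟨insert x.2 x.1, x.2⟩)
      ?_ ?_ ?_ ?_ ?_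
    · rintro ⟨M, e⟩ h
      simp only [mem_sigma, mem_powersetCard, Finset.mem_sdiff] at h ⊢
      exact ⟨⟨(erase_subset _ _).trans h.1.1, by rw [card_erase_of_mem h.2, h.1.2]; rfl⟩,
        h.1.1 h.2, notMem_erase _ _⟩
    · rintro ⟨H, e⟩ h
      simp only [mem_sigma, mem_powersetCard, Finset.mem_sdiff] at h ⊢
      exact ⟨⟨insert_subset h.2.1 h.1.1, by rw [card_insert_of_notMem h.2.2, h.1.2]⟩,
        mem_insert_self _ _⟩
    · rintro ⟨M, e⟩ h
      simp only [mem_sigma] at h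
      simp [insert_erase h.2]
    · rintro ⟨H, e⟩ h
      simp only [mem_sigma, Finset.mem_sdiff] at h
      simp [erase_insert h.2.2]
    · rintro ⟨M, e⟩ _
      rfl
  rw [h, mul_sum]
  refine sum_congr rfl fun H hH => ?_
  rw [mem_powersetCard] at hH
  rw [sum_const, nsmul_eq_mul, card_sdiff_of_subset hH.1,
    Nat.cast_sub (card_le_card hH.1), hH.2]

/-- The averages of a monotone function over the slices increase with the size of the subsets. -/
lemma sliceMean_le_succ {E : Finset ι} {j : ℕ} (hj : j + 1 ≤ #E) {f : Finset ι → ℝ}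
    (hf : Monotone f) : sliceMean E j f ≤ sliceMean E (j + 1) f := by
  have h1 : ((#E : ℝ) - j) * ∑ H ∈ E.powersetCard j, f H
      ≤ (j + 1) * ∑ M ∈ E.powersetCard (j + 1), f M := by
    rw [← sum_sum_erase, mul_sum]
    refine sum_le_sum fun M hM => ?_
    rw [mem_powersetCard] at hM
    calc ∑ e ∈ M, f (M.erase e) ≤ ∑ _e ∈ M, f M := sum_le_sum fun e _ => hf (erase_subset _ _)
      _ = (j + 1) * f M := by rw [sum_const, hM.2, nsmul_eq_mul]; push_cast; ring
  have h2 : ((#E).choose (j + 1) : ℝ) * (j + 1) = (#E).choose j * ((#E : ℝ) - j) := by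
    rw [← Nat.cast_sub (by omega)]
    exact_mod_cast Nat.choose_succ_right_eq (#E) j
  have h3 : (0 : ℝ) < (#E : ℝ) - j := by
    have : ((j + 1 : ℕ) : ℝ) ≤ #E := by exact_mod_cast hj
    push_cast at this; linarith
  have h4 : (0 : ℝ) < (#E).choose j := by exact_mod_cast Nat.choose_pos (by omega)
  rw [sum_powersetCard_eq, sum_powersetCard_eq] at h1
  have h5 : 0 < ((#E).choose j : ℝ) * ((#E : ℝ) - j) := by positivity
  refine le_of_mul_le_mul_left ?_ h5
  calc _ = ((#E : ℝ) - j) * ((#E).choose j * sliceMean E j f) := by ring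
    _ ≤ (j + 1) * ((#E).choose (j + 1) * sliceMean E (j + 1) f) := h1
    _ = _ := by rw [← h2]; ring

lemma sliceMean_mono_size {E : Finset ι} {i j : ℕ} (hij : i ≤ j) (hj : j ≤ #E)
    {f : Finset ι → ℝ} (hf : Monotone f) : sliceMean E i f ≤ sliceMean E j f := by
  induction j, hij using Nat.le_induction with
  | base => exact le_rfl
  | succ j _ ih => exact (ih (by omega)).trans (sliceMean_le_succ hj hf)

/-- Splitting the `(m+1)`-subsets of `E` by whether they contain `e`. -/
lemma sum_powersetCard_succ_erase {E : Finset ι} {e : ι} (he : e ∈ E) (m : ℕ)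
    (f : Finset ι → ℝ) :
    ∑ M ∈ E.powersetCard (m + 1), f M
      = ∑ M ∈ (E.erase e).powersetCard (m + 1), f M
        + ∑ M ∈ (E.erase e).powersetCard m, f (insert e M) := by
  conv_lhs => rw [← insert_erase he, powersetCard_succ_insert (notMem_erase _ _)]
  rw [sum_union, sum_image]
  · intro M hM M' hM' h
    have hM := (mem_powersetCard.1 hM).1
    have hM' := (mem_powersetCard.1 hM').1
    rw [← erase_insert (fun h => notMem_erase e E (hM h)), h,
      erase_insert (fun h => notMem_erase e E (hM' h))]
  · rw [disjoint_left]
    intro M hM h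
    obtain ⟨M', -, rfl⟩ := mem_image.1 h
    exact notMem_erase e E ((mem_powersetCard.1 hM).1 (mem_insert_self _ _))

/-- Removing one element from the ground set and one from the sample lowers the average of a
monotone function: a random `(j+1)`-subset of `E` becomes a random `j`-subset of `E \ {e}` by
deleting `e`, or a random element where `e` is absent. -/
lemma sliceMean_erase_le {E : Finset ι} {e : ι} (he : e ∈ E) {j : ℕ} (hj : j + 1 ≤ #E)
    {f : Finset ι → ℝ} (hf : Monotone f) :
    sliceMean (E.erase e) j f ≤ sliceMean E (j + 1) f := by
  have hc : #E = #(E.erase e) + 1 := (card_erase_add_one he).symm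
  have h1 : ((#(E.erase e)).choose (j + 1) : ℝ) * sliceMean (E.erase e) j f
      ≤ ((#(E.erase e)).choose (j + 1) : ℝ) * sliceMean (E.erase e) (j + 1) f := by
    rcases le_or_gt (j + 1) (#(E.erase e)) with h | h
    · exact mul_le_mul_of_nonneg_left (sliceMean_le_succ h hf) (by positivity)
    · simp [Nat.choose_eq_zero_of_lt h]
  have h2 : ((#E).choose (j + 1) : ℝ) * sliceMean E (j + 1) f
      = ((#(E.erase e)).choose (j + 1) : ℝ) * sliceMean (E.erase e) (j + 1) f
        + ((#(E.erase e)).choose j : ℝ) * sliceMean (E.erase e) j (fun M => f (insert e M)) := by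
    rw [← sum_powersetCard_eq, ← sum_powersetCard_eq, ← sum_powersetCard_eq]
    exact sum_powersetCard_succ_erase he j f
  have h3 : sliceMean (E.erase e) j f ≤ sliceMean (E.erase e) j (fun M => f (insert e M)) :=
    sliceMean_mono fun M _ => hf (subset_insert _ _)
  have h4 : ((#E).choose (j + 1) : ℝ)
      = (#(E.erase e)).choose j + (#(E.erase e)).choose (j + 1) := by
    rw [hc]; exact_mod_cast Nat.choose_succ_succ _ _
  have h5 : (0 : ℝ) < (#E).choose (j + 1) := by exact_mod_cast Nat.choose_pos hj
  refine le_of_mul_le_mul_left ?_ h5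
  rw [h2, h4, add_mul, add_comm]
  exact add_le_add h1 (mul_le_mul_of_nonneg_left h3 (by positivity))

lemma sliceMean_sdiff_le {E S : Finset ι} (hS : S ⊆ E) {j : ℕ} (hj : j + #S ≤ #E)
    {f : Finset ι → ℝ} (hf : Monotone f) :
    sliceMean (E \ S) j f ≤ sliceMean E (j + #S) f := by
  induction S using Finset.induction_on generalizing j with
  | empty => simp
  | insert a S ha ih =>
    rw [card_insert_of_notMem ha] at hj ⊢
    have hS' : S ⊆ E := (subset_insert _ _).trans hS
    have hE : E \ insert a S = (E \ S).erase a := by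
      ext x; simp only [Finset.mem_sdiff, mem_insert, mem_erase]; tauto
    have haE : a ∈ E \ S := Finset.mem_sdiff.2 ⟨hS (mem_insert_self _ _), ha⟩
    rw [hE]
    refine (sliceMean_erase_le haE ?_ hf).trans ?_
    · rw [card_sdiff_of_subset hS']; omega
    · have := ih hS' (j := j + 1) (by omega)
      rwa [show j + (#S + 1) = j + 1 + #S by ring]

/-- Splitting a random `m`-subset `M` of `E` into `M ∩ A` and `M \ A`. -/
lemma sum_powersetCard_inter_sdiff {E A : Finset ι} (hA : A ⊆ E) {m : ℕ} (hm : #A ≤ m)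
    (φ : ℕ → ℝ) (g : Finset ι → ℝ) :
    ∑ M ∈ E.powersetCard m, φ #(M ∩ A) * g (M \ A)
      = ∑ i ∈ range (#A + 1),
          ((#A).choose i : ℝ) * (φ i * ∑ J ∈ (E \ A).powersetCard (m - i), g J) := by
  have h : ∑ M ∈ E.powersetCard m, φ #(M ∩ A) * g (M \ A)
      = ∑ I ∈ A.powerset, ∑ J ∈ (E \ A).powersetCard (m - #I), φ #I * g J := by
    rw [sum_sigma']
    refine sum_bij' (fun M _ => ⟨M ∩ A, M \ A⟩) (fun x _ => x.1 ∪ x.2) ?_ ?_ ?_ ?_ ?_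
    · intro M hM
      simp only [mem_sigma, mem_powersetCard, mem_powerset] at hM ⊢
      refine ⟨inter_subset_right, sdiff_subset_sdiff hM.1 le_rfl, ?_⟩
      have := card_inter_add_card_sdiff M A
      omega
    · rintro ⟨I, J⟩ h
      simp only [mem_sigma, mem_powersetCard, mem_powerset] at h ⊢
      obtain ⟨hI, hJ, hc⟩ := h
      have hd : Disjoint I J := disjoint_of_subset_left hI
        (disjoint_of_subset_right hJ disjoint_sdiff)
      refine ⟨union_subset (hI.trans hA) (hJ.trans sdiff_subset), ?_⟩
      rw [card_union_of_disjoint hd]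
      have := card_le_card hI
      omega
    · intro M _
      exact (union_comm _ _).trans (sdiff_union_inter M A)
    · rintro ⟨I, J⟩ h
      simp only [mem_sigma, mem_powersetCard, mem_powerset] at h
      obtain ⟨hI, hJ, hc⟩ := h
      have hJA : Disjoint J A := disjoint_of_subset_left hJ sdiff_disjoint
      have e1 : (I ∪ J) ∩ A = I := by
        rw [union_inter_distrib_right, inter_eq_left.2 hI, disjoint_iff_inter_eq_empty.1 hJA,
          union_empty]
      have e2 : (I ∪ J) \ A = J := by
        rw [union_sdiff_distrib, sdiff_eq_empty_iff_subset.2 hI, empty_union,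
          sdiff_eq_self_of_disjoint hJA]
      simp [e1, e2]
    · intro M _
      rfl
  rw [h]
  simp_rw [← mul_sum]
  rw [sum_powerset_apply_card (fun i => φ i * ∑ J ∈ (E \ A).powersetCard (m - i), g J)]
  simp [nsmul_eq_mul]

/-- The hypergeometric weight: the probability that a uniformly random `m`-subset of a set with
`K` marked and `B` unmarked elements contains exactly `i` marked ones (for `i ≤ m`). -/
noncomputable def hyp (K B m i : ℕ) : ℝ :=
  (K.choose i : ℝ) * (B.choose (m - i) : ℝ) / ((K + B).choose m : ℝ)

/-- The probability of at least `s` marked elements. -/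
noncomputable def hypTail (K B m s : ℕ) : ℝ :=
  ∑ i ∈ range (K + 1), if s ≤ i then hyp K B m i else 0

lemma hyp_nonneg (K B m i : ℕ) : 0 ≤ hyp K B m i := by unfold hyp; positivity

lemma hypTail_nonneg (K B m s : ℕ) : 0 ≤ hypTail K B m s :=
  sum_nonneg fun i _ => by split_ifs <;> first | exact hyp_nonneg _ _ _ _ | exact le_rfl

/-- The indicator of the event that `M` meets `A` in at least `s` elements. -/
noncomputable def hits (A : Finset ι) (s : ℕ) (M : Finset ι) : ℝ :=
  if s ≤ #(M ∩ A) then 1 else 0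

lemma hits_nonneg (A : Finset ι) (s : ℕ) (M : Finset ι) : 0 ≤ hits A s M := by
  unfold hits; split_ifs <;> norm_num

lemma hits_monotone (A : Finset ι) (s : ℕ) : Monotone (hits A s) := by
  intro M M' h
  have : #(M ∩ A) ≤ #(M' ∩ A) := card_le_card (inter_subset_inter_right h)
  unfold hits
  split_ifs <;> first | omega | norm_num

lemma sliceMean_card_inter {E A : Finset ι} (hA : A ⊆ E) {m : ℕ} (hm : #A ≤ m) (φ : ℕ → ℝ) :
    sliceMean E m (fun M => φ #(M ∩ A))
      = ∑ i ∈ range (#A + 1), φ i * hyp #A (#E - #A) m i := by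
  have := sum_powersetCard_inter_sdiff hA hm φ (fun _ => 1)
  simp only [mul_one, sum_const, card_powersetCard, nsmul_eq_mul,
    card_sdiff_of_subset hA] at this
  rw [sliceMean_eq, this, sum_div]
  refine sum_congr rfl fun i _ => ?_
  rw [hyp, Nat.add_sub_cancel' (card_le_card hA)]
  ring

lemma sliceMean_hits {E A : Finset ι} (hA : A ⊆ E) {m : ℕ} (hm : #A ≤ m) (s : ℕ) :
    sliceMean E m (hits A s) = hypTail #A (#E - #A) m s := by
  have := sliceMean_card_inter hA hm (fun i => if s ≤ i then 1 else 0)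
  simp only [ite_mul, one_mul, zero_mul] at this
  exact this

lemma sum_hyp {K B m : ℕ} (h1 : K ≤ m) (h2 : m ≤ B) : ∑ i ∈ range (K + 1), hyp K B m i = 1 := by
  have h := sliceMean_card_inter (E := range (K + B)) (A := range K) (m := m)
    (by simp) (by simpa using h1) (fun _ => 1)
  simp only [card_range, one_mul, Nat.add_sub_cancel_left] at h
  rw [← h, sliceMean, expect_const]
  rw [powersetCard_nonempty, card_range]
  omega

/-- Negative correlation: the number of sampled points of `A` tends to be small where that of a
disjoint set `B` is large, since the points outside `A` are a uniform sample whose size decreases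
with the former. -/
lemma sliceMean_hits_mul_le {E A B : Finset ι} (hA : A ⊆ E) (hAB : Disjoint A B) {m : ℕ}
    (hm : #A ≤ m) (hm' : m + #A ≤ #E) (s s' : ℕ) :
    sliceMean E m (fun M => hits A s M * hits B s' M)
      ≤ sliceMean E m (hits A s) * sliceMean E m (hits B s') := by
  have hcard : #(E \ A) = #E - #A := card_sdiff_of_subset hA
  have hB : ∀ M, hits B s' M = hits B s' (M \ A) := by
    intro M
    have : M ∩ B = (M \ A) ∩ B := by
      ext x
      simp only [mem_inter, Finset.mem_sdiff]
      exact ⟨fun h => ⟨⟨h.1, fun hx => disjoint_left.1 hAB hx h.2⟩, h.2⟩,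
        fun h => ⟨h.1.1, h.2⟩⟩
    simp only [hits, this]
  -- `γ i` is the conditional probability of the second event when `#(M ∩ A) = i`
  set γ : ℕ → ℝ := fun i => sliceMean (E \ A) (m - i) (hits B s') with hγ
  have key : ∀ φ : ℕ → ℝ, sliceMean E m (fun M => φ #(M ∩ A) * hits B s' M)
      = ∑ i ∈ range (#A + 1), φ i * (hyp #A (#E - #A) m i * γ i) := by
    intro φ
    have := sum_powersetCard_inter_sdiff hA hm φ (hits B s')
    simp_rw [← hB] at this
    rw [sliceMean_eq, this, sum_div]
    refine sum_congr rfl fun i _ => ?_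
    rw [sum_powersetCard_eq, hyp, Nat.add_sub_cancel' (card_le_card hA), hcard]
    ring
  have e1 : sliceMean E m (fun M => hits A s M * hits B s' M)
      = ∑ i ∈ range (#A + 1) with s ≤ i, hyp #A (#E - #A) m i * γ i := by
    have := key (fun i => if s ≤ i then 1 else 0)
    simp only [ite_mul, one_mul, zero_mul] at this
    rw [sum_filter, ← this]
    exact sliceMean_congr fun M _ => by simp only [hits, ite_mul, one_mul, zero_mul]
  have e2 : sliceMean E m (hits B s')
      = ∑ i ∈ range (#A + 1) with s ≤ i, hyp #A (#E - #A) m i * γ i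
        + ∑ i ∈ range (#A + 1) with ¬ s ≤ i, hyp #A (#E - #A) m i * γ i := by
    rw [sum_filter_add_sum_filter_not]
    have := key (fun _ => 1)
    simpa using this
  have e3 : sliceMean E m (hits A s)
      = ∑ i ∈ range (#A + 1) with s ≤ i, hyp #A (#E - #A) m i := by
    rw [sliceMean_hits hA hm, hypTail, sum_filter]
  have e4 : ∑ i ∈ range (#A + 1) with s ≤ i, hyp #A (#E - #A) m i
      + ∑ i ∈ range (#A + 1) with ¬ s ≤ i, hyp #A (#E - #A) m i = 1 := by
    rw [sum_filter_add_sum_filter_not]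
    exact sum_hyp hm (by omega)
  have hanti : ∀ i j, i ≤ j → γ j ≤ γ i := fun i j hij =>
    sliceMean_mono_size (by omega) (by omega) (hits_monotone B s')
  have f1 : ∑ i ∈ range (#A + 1) with s ≤ i, hyp #A (#E - #A) m i * γ i
      ≤ (∑ i ∈ range (#A + 1) with s ≤ i, hyp #A (#E - #A) m i) * γ s := by
    rw [sum_mul]
    refine sum_le_sum fun i hi => mul_le_mul_of_nonneg_left (hanti _ _ (mem_filter.1 hi).2)
      (hyp_nonneg _ _ _ _)
  have f2 : (∑ i ∈ range (#A + 1) with ¬ s ≤ i, hyp #A (#E - #A) m i) * γ s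
      ≤ ∑ i ∈ range (#A + 1) with ¬ s ≤ i, hyp #A (#E - #A) m i * γ i := by
    rw [sum_mul]
    refine sum_le_sum fun i hi => mul_le_mul_of_nonneg_left
      (hanti _ _ (not_le.1 (mem_filter.1 hi).2).le) (hyp_nonneg _ _ _ _)
  have n1 : 0 ≤ ∑ i ∈ range (#A + 1) with s ≤ i, hyp #A (#E - #A) m i :=
    sum_nonneg fun i _ => hyp_nonneg _ _ _ _
  have n2 : 0 ≤ ∑ i ∈ range (#A + 1) with ¬ s ≤ i, hyp #A (#E - #A) m i :=
    sum_nonneg fun i _ => hyp_nonneg _ _ _ _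
  rw [e1, e2, e3]
  generalize ∑ i ∈ range (#A + 1) with s ≤ i, hyp #A (#E - #A) m i = H at *
  generalize ∑ i ∈ range (#A + 1) with ¬ s ≤ i, hyp #A (#E - #A) m i = H' at *
  generalize ∑ i ∈ range (#A + 1) with s ≤ i, hyp #A (#E - #A) m i * γ i = a at *
  generalize ∑ i ∈ range (#A + 1) with ¬ s ≤ i, hyp #A (#E - #A) m i * γ i = b at *
  have g1 := mul_le_mul_of_nonneg_left f1 n2
  have g2 := mul_le_mul_of_nonneg_left f2 n1
  calc a = H * a + H' * a := by rw [← add_mul, e4, one_mul]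
    _ ≤ H * (a + b) := by linarith

end Slices

/-! ### The hypergeometric distribution: moments and ratios of consecutive weights -/

section Hypergeometric

/-- The mean of the hypergeometric distribution. -/
noncomputable def hypMean (K B m : ℕ) : ℝ := (K : ℝ) * m / ((K : ℝ) + B)

/-- The variance of the binomial distribution with `K` trials and success probability
`m / (K + B)`, which is slightly larger than that of the hypergeometric distribution. -/
noncomputable def binVar (K B m : ℕ) : ℝ := hypMean K B m * (1 - (m : ℝ) / ((K : ℝ) + B))

lemma hyp_eq_zero {K B m i : ℕ} (h : K < i) : hyp K B m i = 0 := by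
  simp [hyp, Nat.choose_eq_zero_of_lt h]

lemma hyp_succ {K B m i : ℕ} (hm : i < m) :
    hyp K B m (i + 1) * ((i + 1) * ((B : ℝ) - m + i + 1))
      = hyp K B m i * (((K : ℝ) - i) * ((m : ℝ) - i)) := by
  have h1 : (K.choose (i + 1) : ℝ) * (i + 1) = K.choose i * ((K : ℝ) - i) := by
    rcases lt_trichotomy i K with h | h | h
    · rw [← Nat.cast_sub h.le]; exact_mod_cast Nat.choose_succ_right_eq K i
    · subst h; simp
    · simp [Nat.choose_eq_zero_of_lt h, Nat.choose_eq_zero_of_lt (h.trans (Nat.lt_succ_self i))]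
  obtain ⟨j, rfl⟩ : ∃ j, m = i + 1 + j := ⟨m - (i + 1), by omega⟩
  have h2 : (B.choose (j + 1) : ℝ) * (j + 1) = B.choose j * ((B : ℝ) - j) := by
    rcases lt_trichotomy j B with h | h | h
    · rw [← Nat.cast_sub h.le]; exact_mod_cast Nat.choose_succ_right_eq B j
    · subst h; simp
    · simp [Nat.choose_eq_zero_of_lt h, Nat.choose_eq_zero_of_lt (h.trans (Nat.lt_succ_self j))]
  unfold hyp
  rw [show i + 1 + j - (i + 1) = j by omega, show i + 1 + j - i = j + 1 by omega]
  push_cast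
  rw [div_mul_eq_mul_div, div_mul_eq_mul_div]
  congr 1
  linear_combination (B.choose j : ℝ) * ((B : ℝ) - j) * h1 - (K.choose i : ℝ) * ((K : ℝ) - i) * h2

/-- Size biasing: weighting by the number of marked elements amounts to sampling one marked
element beforehand. -/
lemma succ_mul_hyp_succ (K B m i : ℕ) :
    ((i : ℝ) + 1) * hyp (K + 1) B (m + 1) (i + 1) = hypMean (K + 1) B (m + 1) * hyp K B m i := by
  have h1 : ((K : ℝ) + 1) * K.choose i = (K + 1).choose (i + 1) * (i + 1) := by
    exact_mod_cast Nat.add_one_mul_choose_eq K i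
  have h2 : ((K : ℝ) + B + 1) * (K + B).choose m = (K + 1 + B).choose (m + 1) * (m + 1) := by
    rw [show K + 1 + B = K + B + 1 by ring]
    exact_mod_cast Nat.add_one_mul_choose_eq (K + B) m
  unfold hyp hypMean
  rw [show m + 1 - (i + 1) = m - i by omega]
  have hN : (0 : ℝ) < (K : ℝ) + 1 + B := by positivity
  rcases Nat.eq_zero_or_pos ((K + B).choose m) with h0 | h0
  · have : (K + 1 + B).choose (m + 1) = 0 := by
      rw [Nat.choose_eq_zero_iff] at h0 ⊢; omega
    simp [h0, this]
  · have h0' : 0 < (K + 1 + B).choose (m + 1) := by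
      have : ¬ K + B < m := fun h => h0.ne' (Nat.choose_eq_zero_of_lt h)
      exact Nat.choose_pos (by omega)
    have p0 : (0 : ℝ) < (K + B).choose m := by exact_mod_cast h0
    have p0' : (0 : ℝ) < (K + 1 + B).choose (m + 1) := by exact_mod_cast h0'
    push_cast
    field_simp
    linear_combination (-(B.choose (m - i) : ℝ) * (K + 1 + B) * ((K + B).choose m : ℝ)) * h1
      + (B.choose (m - i) : ℝ) * (K.choose i : ℝ) * (K + 1) * h2

lemma sum_mul_hyp (K B m : ℕ) (f : ℕ → ℝ) :
    ∑ i ∈ range (K + 2), (i : ℝ) * f i * hyp (K + 1) B (m + 1) i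
      = hypMean (K + 1) B (m + 1) * ∑ i ∈ range (K + 1), f (i + 1) * hyp K B m i := by
  rw [sum_range_succ', mul_sum]
  simp only [Nat.cast_zero, zero_mul, add_zero]
  refine sum_congr rfl fun i _ => ?_
  have := succ_mul_hyp_succ K B m i
  push_cast
  linear_combination f (i + 1) * this

lemma sum_id_mul_hyp {K B m : ℕ} (h0 : 1 ≤ K) (h1 : K ≤ m) (h2 : m ≤ B) :
    ∑ i ∈ range (K + 1), (i : ℝ) * hyp K B m i = hypMean K B m := by
  obtain ⟨K, rfl⟩ : ∃ k, K = k + 1 := ⟨K - 1, by omega⟩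
  obtain ⟨m, rfl⟩ : ∃ k, m = k + 1 := ⟨m - 1, by omega⟩
  have := sum_mul_hyp K B m (fun _ => 1)
  simp only [mul_one, one_mul] at this
  rw [this, sum_hyp (by omega) (by omega), mul_one]

lemma sum_sq_sub_hypMean_le {K B m : ℕ} (h0 : 2 ≤ K) (h1 : K ≤ m) (h2 : m ≤ B) :
    ∑ i ∈ range (K + 1), ((i : ℝ) - hypMean K B m) ^ 2 * hyp K B m i ≤ binVar K B m := by
  have e0 := sum_hyp h1 h2
  have e1 := sum_id_mul_hyp (by omega) h1 h2
  have e2 : ∑ i ∈ range (K + 1), (i : ℝ) * ((i : ℝ) - 1) * hyp K B m i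
      = hypMean K B m * hypMean (K - 1) B (m - 1) := by
    obtain ⟨K, rfl⟩ : ∃ k, K = k + 1 := ⟨K - 1, by omega⟩
    obtain ⟨m, rfl⟩ : ∃ k, m = k + 1 := ⟨m - 1, by omega⟩
    have := sum_mul_hyp K B m (fun i => (i : ℝ) - 1)
    rw [this]
    simp only [Nat.cast_add, Nat.cast_one, add_sub_cancel_right, Nat.add_sub_cancel]
    rw [sum_id_mul_hyp (by omega) (by omega) (by omega)]
  have e3 : ∑ i ∈ range (K + 1), ((i : ℝ) - hypMean K B m) ^ 2 * hyp K B m i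
      = hypMean K B m * hypMean (K - 1) B (m - 1) + hypMean K B m - hypMean K B m ^ 2 := by
    have : ∀ i ∈ range (K + 1), ((i : ℝ) - hypMean K B m) ^ 2 * hyp K B m i
        = (i : ℝ) * ((i : ℝ) - 1) * hyp K B m i + (1 - 2 * hypMean K B m) * ((i : ℝ) * hyp K B m i)
          + hypMean K B m ^ 2 * hyp K B m i := fun i _ => by ring
    rw [sum_congr rfl this, sum_add_distrib, sum_add_distrib, ← mul_sum, ← mul_sum, e0, e1, e2]
    ring
  rw [e3, binVar]
  have hμ : 0 ≤ hypMean K B m := by unfold hypMean; positivity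
  have hle : hypMean (K - 1) B (m - 1) + (m : ℝ) / ((K : ℝ) + B) ≤ hypMean K B m := by
    unfold hypMean
    have hK : (2 : ℝ) ≤ K := by exact_mod_cast h0
    have hm : (K : ℝ) ≤ m := by exact_mod_cast h1
    have hB : (m : ℝ) ≤ B := by exact_mod_cast h2
    rw [Nat.cast_sub (by omega), Nat.cast_sub (by omega), Nat.cast_one]
    have p1 : (0 : ℝ) < (K : ℝ) + B := by linarith
    have p2 : (0 : ℝ) < (K : ℝ) - 1 + B := by linarith
    have : ((m : ℝ) - 1) / ((K : ℝ) - 1 + B) ≤ m / ((K : ℝ) + B) := by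
      rw [div_le_div_iff₀ p2 p1]; nlinarith
    have h3 : ((K : ℝ) - 1) * ((m - 1) / ((K : ℝ) - 1 + B)) ≤ (K - 1) * (m / ((K : ℝ) + B)) :=
      mul_le_mul_of_nonneg_left this (by linarith)
    calc _ = ((K : ℝ) - 1) * ((m - 1) / ((K : ℝ) - 1 + B)) + m / ((K : ℝ) + B) := by ring
      _ ≤ (K - 1) * (m / ((K : ℝ) + B)) + m / ((K : ℝ) + B) := by linarith
      _ = _ := by ring
  nlinarith [mul_le_mul_of_nonneg_left hle hμ]

/-- Sampling one marked element beforehand inflates an upper tail by a bounded factor, because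
the weights decay at least geometrically beyond twice the mean. -/
lemma hypTail_le_mul_hypTail_succ {K B m s : ℕ} (h1 : K ≤ m)
    (hN : (K : ℝ) + 1 + B ≤ 2 * ((B : ℝ) - m)) :
    hypTail K B m s
      ≤ (((s : ℝ) + 1) / hypMean (K + 1) B (m + 1) + 2) * hypTail (K + 1) B (m + 1) (s + 1) := by
  set μ := hypMean (K + 1) B (m + 1) with hμd
  have hμ : 0 < μ := by rw [hμd]; unfold hypMean; positivity
  set h := hyp (K + 1) B (m + 1) with hh
  have h0 : ∀ i, 0 ≤ h i := fun i => hyp_nonneg _ _ _ _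
  have step : ∀ i ∈ range (K + 1), ((i : ℝ) + 2) * h (i + 2) ≤ 2 * μ * h (i + 1) := by
    intro i hi
    rw [mem_range] at hi
    rcases Nat.lt_or_ge K (i + 1) with hiK | hiK
    · have : h (i + 2) = 0 := hyp_eq_zero (by omega)
      rw [this, mul_zero]
      exact mul_nonneg (by positivity) (h0 _)
    have := hyp_succ (K := K + 1) (B := B) (m := m + 1) (i := i + 1) (by omega)
    push_cast at this
    rw [← hh, show ((i : ℝ) + 1 + 1) = i + 2 by ring] at this
    have hi' : (i : ℝ) + 1 ≤ K := by exact_mod_cast hiK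
    have hm' : (K : ℝ) ≤ m := by exact_mod_cast h1
    have hpos : (0 : ℝ) < (K : ℝ) + 1 + B := by positivity
    have b1 : ((K : ℝ) + 1 - (i + 1)) * ((m : ℝ) + 1 - (i + 1)) ≤ (K + 1) * (m + 1) := by
      apply mul_le_mul <;> linarith
    have b2 : ((K : ℝ) + 1 + B) / 2 ≤ (B : ℝ) - (m + 1) + (i + 1) + 1 := by
      have : (0 : ℝ) ≤ i := by positivity
      linarith
    have e : (((K : ℝ) + 1) * (m + 1)) = μ * (K + 1 + B) := by
      rw [hμd]; unfold hypMean; push_cast; field_simp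
    have c1 : h (i + 2) * (((i : ℝ) + 2) * (((K : ℝ) + 1 + B) / 2))
        ≤ h (i + 1) * (μ * (K + 1 + B)) := by
      calc _ ≤ h (i + 2) * (((i : ℝ) + 2) * ((B : ℝ) - (m + 1) + (i + 1) + 1)) := by
            have := h0 (i + 2)
            gcongr
        _ = h (i + 1) * (((K : ℝ) + 1 - (i + 1)) * ((m : ℝ) + 1 - (i + 1))) := this
        _ ≤ _ := by rw [← e]; exact mul_le_mul_of_nonneg_left b1 (h0 _)
    have c2 : (((i : ℝ) + 2) * h (i + 2)) * (((K : ℝ) + 1 + B) / 2)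
        ≤ (2 * μ * h (i + 1)) * (((K : ℝ) + 1 + B) / 2) := by linarith
    exact le_of_mul_le_mul_right c2 (by positivity)
  have q1 : ∀ i ∈ range (K + 1), (if s ≤ i then hyp K B m i else 0)
      = (if s ≤ i then ((i : ℝ) + 1) * h (i + 1) else 0) / μ := by
    intro i _
    split_ifs
    · rw [hh, succ_mul_hyp_succ, ← hμd]; field_simp
    · simp
  have q2 : hypTail (K + 1) B (m + 1) (s + 1)
      = ∑ i ∈ range (K + 1), if s ≤ i then h (i + 1) else 0 := by
    rw [hypTail, sum_range_succ', if_neg (by omega), add_zero]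
    refine sum_congr rfl fun i _ => ?_
    simp only [Nat.add_le_add_iff_right]; rfl
  -- the term `i = s` is kept apart, and the others are bounded by the preceding weight
  have q3 : ∑ i ∈ range (K + 1), (if s ≤ i then ((i : ℝ) + 1) * h (i + 1) else 0)
      ≤ ∑ i ∈ range (K + 1), ((if s ≤ i then ((s : ℝ) + 1) * h (i + 1) else 0)
          + if s ≤ i then 2 * μ * h (i + 1) else 0) := by
    have t1 : ∀ i, (if s ≤ i then ((i : ℝ) + 1) * h (i + 1) else 0)
        = (if i = s then ((s : ℝ) + 1) * h (i + 1) else 0)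
          + (if s + 1 ≤ i then ((i : ℝ) + 1) * h (i + 1) else 0) := by
      intro i
      rcases lt_trichotomy i s with c | c | c
      · rw [if_neg (by omega), if_neg (by omega), if_neg (by omega), add_zero]
      · subst c; simp
      · rw [if_pos (by omega), if_neg (by omega), if_pos (by omega), zero_add]
    rw [sum_congr rfl fun i _ => t1 i, sum_add_distrib, sum_add_distrib]
    refine add_le_add (sum_le_sum fun i _ => ?_) ?_
    · split_ifs <;> first | omega | exact le_rfl | exact mul_nonneg (by positivity) (h0 _)
    · rw [sum_range_succ', if_neg (by omega), add_zero]
      calc _ ≤ ∑ i ∈ range K, (if s ≤ i then 2 * μ * h (i + 1) else 0) := by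
            refine sum_le_sum fun i hi => ?_
            simp only [Nat.add_le_add_iff_right]
            split_ifs
            · have := step i (by simp at hi ⊢; omega)
              push_cast
              rw [show ((i : ℝ) + 1 + 1) = i + 2 by ring]
              exact this
            · exact le_rfl
        _ ≤ _ := by
            rw [sum_range_succ]
            have : 0 ≤ (if s ≤ K then 2 * μ * h (K + 1) else 0) := by
              split_ifs
              · exact mul_nonneg (by positivity) (h0 _)
              · exact le_rfl
            linarith
  calc hypTail K B m s
      = (∑ i ∈ range (K + 1), (if s ≤ i then ((i : ℝ) + 1) * h (i + 1) else 0)) / μ := by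
        rw [hypTail, sum_congr rfl q1, sum_div]
    _ ≤ (∑ i ∈ range (K + 1), ((if s ≤ i then ((s : ℝ) + 1) * h (i + 1) else 0)
          + if s ≤ i then 2 * μ * h (i + 1) else 0)) / μ := by gcongr
    _ = _ := by
        rw [q2, sum_add_distrib]
        simp_rw [← mul_ite_zero, ← mul_sum]
        field_simp

end Hypergeometric

/-! ### The hypergeometric distribution: upper bound for the tail -/

section TailBounds

variable {K B m : ℕ}

lemma hypMean_pos (h0 : 1 ≤ K) (h1 : K ≤ m) : 0 < hypMean K B m := by
  have : (0 : ℝ) < K := by exact_mod_cast h0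
  have : (0 : ℝ) < m := by exact_mod_cast h0.trans h1
  unfold hypMean; positivity

lemma hypMean_mul (h0 : 1 ≤ K) : hypMean K B m * ((K : ℝ) + B) = K * m := by
  have : (0 : ℝ) < K := by exact_mod_cast h0
  unfold hypMean; field_simp

/-- With `y = i - μ`, the four factors of the ratio of consecutive weights are perturbations of
`K - μ`, `m - μ`, `μ` and `B - m + μ`, and the products of the first two and of the last two of
these agree. -/
lemma hypMean_factors (h0 : 1 ≤ K) :
    ((K : ℝ) - hypMean K B m) * (m - hypMean K B m)
      = hypMean K B m * ((B : ℝ) - m + hypMean K B m) := by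
  linear_combination -(hypMean_mul (B := B) (m := m) h0)

lemma hypMean_lt_left (h0 : 1 ≤ K) (h1 : K ≤ m) (h2 : m ≤ B) : hypMean K B m < K := by
  have e := hypMean_mul (B := B) (m := m) h0
  have hK : (1 : ℝ) ≤ K := by exact_mod_cast h0
  have hm : (K : ℝ) ≤ m := by exact_mod_cast h1
  have hB : (m : ℝ) ≤ B := by exact_mod_cast h2
  have : (0 : ℝ) < (K : ℝ) + B := by linarith
  refine lt_of_mul_lt_mul_right (a := (K : ℝ) + B) ?_ this.le
  rw [e]; nlinarith

lemma hypMean_lt_right (h0 : 1 ≤ K) (h1 : K ≤ m) (h2 : m ≤ B) : hypMean K B m < m := by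
  have := hypMean_lt_left h0 h1 h2
  have hm : (K : ℝ) ≤ m := by exact_mod_cast h1
  linarith

lemma binVar_inv (h0 : 1 ≤ K) (h1 : K ≤ m) (h2 : m ≤ B) :
    1 / binVar K B m = 1 / ((K : ℝ) - hypMean K B m) + 1 / hypMean K B m := by
  have a := hypMean_pos (B := B) h0 h1
  have b := sub_pos.2 (hypMean_lt_left h0 h1 h2)
  have hK : (0 : ℝ) < K := by exact_mod_cast h0
  have hN : (0 : ℝ) < (K : ℝ) + B := by positivity
  have e : binVar K B m = hypMean K B m * (K - hypMean K B m) / K := by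
    have : (m : ℝ) / ((K : ℝ) + B) = hypMean K B m / K := by
      unfold hypMean; field_simp
    rw [binVar, this]; field_simp
  rw [e]
  field_simp
  ring

lemma binVar_pos (h0 : 1 ≤ K) (h1 : K ≤ m) (h2 : m ≤ B) : 0 < binVar K B m := by
  rw [← one_div_pos, binVar_inv h0 h1 h2]
  have a := hypMean_pos (B := B) h0 h1
  have b := sub_pos.2 (hypMean_lt_left h0 h1 h2)
  positivity

lemma binVar_le_mean (h0 : 1 ≤ K) (h1 : K ≤ m) : binVar K B m ≤ hypMean K B m := by
  have a := hypMean_pos (B := B) h0 h1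
  have : (0 : ℝ) ≤ (m : ℝ) / ((K : ℝ) + B) := by positivity
  unfold binVar; nlinarith

lemma binVar_le_left (h0 : 1 ≤ K) (h1 : K ≤ m) (h2 : m ≤ B) :
    binVar K B m ≤ K - hypMean K B m := by
  have a := hypMean_pos (B := B) h0 h1
  have b := sub_pos.2 (hypMean_lt_left h0 h1 h2)
  rw [← one_div_le_one_div b (binVar_pos h0 h1 h2), binVar_inv h0 h1 h2]
  have : 0 < 1 / hypMean K B m := by positivity
  linarith

lemma hyp_succ_mul_le (h0 : 1 ≤ K) (h1 : K ≤ m) (h2 : m ≤ B) {i : ℕ}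
    (hi : hypMean K B m ≤ i) :
    hyp K B m (i + 1) * i ≤ hyp K B m i * hypMean K B m := by
  set μ := hypMean K B m with hμd
  have a : 0 < μ := hypMean_pos (B := B) h0 h1
  have b := hypMean_lt_left h0 h1 h2
  rw [← hμd] at b
  have hm : (K : ℝ) ≤ m := by exact_mod_cast h1
  have hB : (m : ℝ) ≤ B := by exact_mod_cast h2
  rcases Nat.lt_or_ge i K with hK | hK
  · have e := hyp_succ (K := K) (B := B) (m := m) (i := i) (by omega)
    have f := hypMean_factors (B := B) (m := m) h0
    rw [← hμd] at f
    have hK' : (i : ℝ) < K := by exact_mod_cast hK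
    have g0 := hyp_nonneg K B m i
    have g1 := hyp_nonneg K B m (i + 1)
    have p : 0 < (B : ℝ) - m + μ := by linarith
    have c1 : ((K : ℝ) - i) * (m - i) ≤ μ * (B - m + μ) := by
      rw [← f]; apply mul_le_mul <;> linarith
    have c2 : (i : ℝ) * ((B : ℝ) - m + μ) ≤ (i + 1) * (B - m + i + 1) := by
      apply mul_le_mul <;> linarith
    refine le_of_mul_le_mul_right ?_ p
    calc _ = hyp K B m (i + 1) * (i * ((B : ℝ) - m + μ)) := by ring
      _ ≤ hyp K B m (i + 1) * ((i + 1) * (B - m + i + 1)) := mul_le_mul_of_nonneg_left c2 g1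
      _ = hyp K B m i * (((K : ℝ) - i) * (m - i)) := e
      _ ≤ hyp K B m i * (μ * (B - m + μ)) := mul_le_mul_of_nonneg_left c1 g0
      _ = _ := by ring
  · rw [hyp_eq_zero (by omega), zero_mul]
    exact mul_nonneg (hyp_nonneg _ _ _ _) a.le

lemma hyp_succ_le (h0 : 1 ≤ K) (h1 : K ≤ m) (h2 : m ≤ B) {i : ℕ}
    (hi : hypMean K B m ≤ i) : hyp K B m (i + 1) ≤ hyp K B m i := by
  have a := hypMean_pos (B := B) h0 h1
  have h := hyp_succ_mul_le h0 h1 h2 hi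
  have := mul_le_mul_of_nonneg_left hi (hyp_nonneg K B m i)
  exact le_of_mul_le_mul_right (h.trans this) (a.trans_le hi)

lemma hyp_antitone (h0 : 1 ≤ K) (h1 : K ≤ m) (h2 : m ≤ B) {i j : ℕ}
    (hi : hypMean K B m ≤ i) (hij : i ≤ j) : hyp K B m j ≤ hyp K B m i := by
  induction j, hij using Nat.le_induction with
  | base => exact le_rfl
  | succ j hj ih =>
    have : (i : ℝ) ≤ j := by exact_mod_cast hj
    exact (hyp_succ_le h0 h1 h2 (hi.trans this)).trans ih

lemma sum_hyp_le_one (h1 : K ≤ m) (h2 : m ≤ B) (s : Finset ℕ) : ∑ i ∈ s, hyp K B m i ≤ 1 := by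
  have e : ∑ i ∈ s, hyp K B m i = ∑ i ∈ s with i ∈ range (K + 1), hyp K B m i := by
    rw [sum_filter]
    refine sum_congr rfl fun i _ => ?_
    split_ifs with h
    · rfl
    · exact hyp_eq_zero (by simpa using h)
  rw [e, ← sum_hyp h1 h2]
  exact sum_le_sum_of_subset_of_nonneg (fun i hi => (mem_filter.1 hi).2)
    fun i _ _ => hyp_nonneg _ _ _ _

/-- A weight beyond the mean is at most the reciprocal of its distance to the mean, since the
weights in between are at least as large and sum to at most `1`. -/
lemma hyp_mul_le_one (h0 : 1 ≤ K) (h1 : K ≤ m) (h2 : m ≤ B) {b : ℕ}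
    (hb : hypMean K B m ≤ b) : ((b : ℝ) - hypMean K B m) * hyp K B m b ≤ 1 := by
  have a := hypMean_pos (B := B) h0 h1
  set c := ⌈hypMean K B m⌉₊
  have hc : hypMean K B m ≤ c := Nat.le_ceil _
  have hc' : (c : ℝ) < hypMean K B m + 1 := Nat.ceil_lt_add_one a.le
  have hcb : c ≤ b := Nat.ceil_le.2 hb
  have h : (#(Icc c b) : ℝ) * hyp K B m b ≤ 1 := by
    refine le_trans ?_ (sum_hyp_le_one h1 h2 (Icc c b))
    rw [← nsmul_eq_mul]
    refine card_nsmul_le_sum _ _ _ fun i hi => ?_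
    rw [mem_Icc] at hi
    have : (c : ℝ) ≤ i := by exact_mod_cast hi.1
    exact hyp_antitone h0 h1 h2 (hc.trans this) hi.2
  rw [Nat.card_Icc, Nat.cast_sub (by omega)] at h
  push_cast at h
  refine le_trans (mul_le_mul_of_nonneg_right ?_ (hyp_nonneg _ _ _ _)) h
  linarith

/-- Beyond the mean the weights decay geometrically, so that the tail is comparable to its first
term. -/
lemma hypTail_mul_le (h0 : 1 ≤ K) (h1 : K ≤ m) (h2 : m ≤ B) {s : ℕ} (hs : hypMean K B m ≤ s) :
    ((s : ℝ) - hypMean K B m) * hypTail K B m s ≤ s * hyp K B m s := by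
  have a := hypMean_pos (B := B) h0 h1
  have key : ∀ n, s ≤ n → ((s : ℝ) - hypMean K B m) * ∑ i ∈ Ico s n, hyp K B m i
      ≤ s * (hyp K B m s - hyp K B m n) := by
    intro n hn
    induction n, hn using Nat.le_induction with
    | base => simp
    | succ n hn ih =>
      have hn' : (s : ℝ) ≤ n := by exact_mod_cast hn
      have h := hyp_succ_mul_le h0 h1 h2 (hs.trans hn')
      have := mul_le_mul_of_nonneg_left hn' (hyp_nonneg K B m (n + 1))
      rw [sum_Ico_succ_top hn, mul_add]
      nlinarith
  have e : hypTail K B m s ≤ ∑ i ∈ Ico s (max s (K + 1)), hyp K B m i := by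
    rw [hypTail, ← sum_filter]
    refine sum_le_sum_of_subset_of_nonneg (fun i hi => ?_) fun i _ _ => hyp_nonneg _ _ _ _
    simp only [mem_filter, Finset.mem_range, mem_Ico, lt_max_iff] at hi ⊢
    omega
  refine (mul_le_mul_of_nonneg_left e (sub_nonneg.2 hs)).trans
    ((key _ (le_max_left _ _)).trans ?_)
  have := hyp_nonneg K B m (max s (K + 1))
  have hs0 : (0 : ℝ) ≤ s := by positivity
  nlinarith

lemma exp_sub_sq_div_two_le {z : ℝ} (hz : 0 ≤ z) : Real.exp (z - z ^ 2 / 2) ≤ 1 + z := by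
  have h : z - z ^ 2 / 2 ≤ Real.log (1 + z) := by
    refine le_trans ?_ (Real.le_log_one_add_of_nonneg hz)
    rw [le_div_iff₀ (by linarith)]
    nlinarith [pow_nonneg hz 3]
  calc _ ≤ Real.exp (Real.log (1 + z)) := Real.exp_le_exp.2 h
    _ = _ := Real.exp_log (by linarith)

/-- The ratio of consecutive weights is at most that of a Gaussian density, up to a factor with
a second-order exponent. -/
lemma hyp_succ_le_exp (h0 : 1 ≤ K) (h1 : K ≤ m) (h2 : m ≤ B) {i : ℕ}
    (hi : hypMean K B m ≤ i) :
    hyp K B m (i + 1) ≤ hyp K B m i *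
      Real.exp (-((i : ℝ) - hypMean K B m) / binVar K B m
        + ((i : ℝ) - hypMean K B m + 1) ^ 2 / (2 * hypMean K B m ^ 2)) := by
  have hV := binVar_inv h0 h1 h2
  have f := hypMean_factors (B := B) (m := m) h0
  have a : 0 < hypMean K B m := hypMean_pos (B := B) h0 h1
  have b := hypMean_lt_left h0 h1 h2
  have b' := hypMean_lt_right h0 h1 h2
  have hB : (m : ℝ) ≤ B := by exact_mod_cast h2
  have g0 := hyp_nonneg K B m i
  have g1 := hyp_nonneg K B m (i + 1)
  rcases Nat.lt_or_ge i K with hK | hK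
  swap
  · rw [hyp_eq_zero (by omega)]
    exact mul_nonneg g0 (Real.exp_pos _).le
  have e := hyp_succ (K := K) (B := B) (m := m) (i := i) (by omega)
  have hK' : (i : ℝ) < K := by exact_mod_cast hK
  have hm : (K : ℝ) ≤ m := by exact_mod_cast h1
  set μ := hypMean K B m
  set y := (i : ℝ) - μ with hy
  have hy0 : 0 ≤ y := sub_nonneg.2 hi
  have d1 : 0 < (K : ℝ) - μ := by linarith
  have d4 : 0 < (B : ℝ) - m + μ := by linarith
  have c1 : (K : ℝ) - i ≤ ((K : ℝ) - μ) * Real.exp (-(y / (K - μ))) := by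
    have := mul_le_mul_of_nonneg_left (Real.one_sub_le_exp_neg (y / (K - μ))) d1.le
    refine le_trans (le_of_eq ?_) this
    rw [hy]; field_simp; ring
  have c2 : (m : ℝ) - i ≤ m - μ := by linarith
  have c3 : μ * Real.exp ((y + 1) / μ - ((y + 1) / μ) ^ 2 / 2) ≤ i + 1 := by
    have := mul_le_mul_of_nonneg_left
      (exp_sub_sq_div_two_le (z := (y + 1) / μ) (by positivity)) a.le
    refine this.trans (le_of_eq ?_)
    rw [hy]; field_simp; ring
  have c4 : (B : ℝ) - m + μ ≤ B - m + i + 1 := by linarith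
  set e1 := Real.exp (-(y / (K - μ)))
  set e2 := Real.exp ((y + 1) / μ - ((y + 1) / μ) ^ 2 / 2) with he2
  have p1 : 0 < e1 := Real.exp_pos _
  have p2 : 0 < e2 := Real.exp_pos _
  have c5 : hyp K B m (i + 1) * e2 ≤ hyp K B m i * e1 := by
    have p : 0 < μ * ((B : ℝ) - m + μ) := by positivity
    refine le_of_mul_le_mul_right ?_ p
    calc hyp K B m (i + 1) * e2 * (μ * ((B : ℝ) - m + μ))
        = hyp K B m (i + 1) * ((μ * e2) * ((B : ℝ) - m + μ)) := by ring
      _ ≤ hyp K B m (i + 1) * ((i + 1) * (B - m + i + 1)) := by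
          refine mul_le_mul_of_nonneg_left ?_ g1
          exact mul_le_mul c3 c4 d4.le (by positivity)
      _ = hyp K B m i * (((K : ℝ) - i) * (m - i)) := e
      _ ≤ hyp K B m i * ((((K : ℝ) - μ) * e1) * (m - μ)) := by
          refine mul_le_mul_of_nonneg_left ?_ g0
          exact mul_le_mul c1 c2 (by linarith) (by positivity)
      _ = hyp K B m i * e1 * (μ * ((B : ℝ) - m + μ)) := by rw [← f]; ring
  have c6 : hyp K B m (i + 1) ≤ hyp K B m i * (e1 / e2) := by
    rw [← mul_div_assoc, le_div_iff₀ p2]; exact c5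
  refine c6.trans (mul_le_mul_of_nonneg_left ?_ g0)
  rw [← Real.exp_sub, Real.exp_le_exp]
  have hV' : -y / binVar K B m = -(y / (K - μ)) - y / μ := by
    rw [div_eq_mul_one_div, hV]; ring
  rw [hV']
  have : (y + 1) / μ = y / μ + 1 / μ := by ring
  have h1μ : 0 ≤ 1 / μ := by positivity
  have hsq : ((y + 1) / μ) ^ 2 / 2 = (y + 1) ^ 2 / (2 * μ ^ 2) := by field_simp
  rw [hsq]
  linarith

lemma hyp_le_exp_of_le (h0 : 1 ≤ K) (h1 : K ≤ m) (h2 : m ≤ B) {b s : ℕ}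
    (hb : hypMean K B m ≤ b) (hbs : b ≤ s) {Y : ℝ} (hY : (s : ℝ) - hypMean K B m ≤ Y) :
    hyp K B m s ≤ hyp K B m b *
      Real.exp (-((((s : ℝ) - hypMean K B m) * ((s : ℝ) - hypMean K B m - 1)
          - ((b : ℝ) - hypMean K B m) * ((b : ℝ) - hypMean K B m - 1)) / (2 * binVar K B m))
        + ((s : ℝ) - b) * (Y ^ 2 / (2 * hypMean K B m ^ 2))) := by
  induction s, hbs using Nat.le_induction with
  | base => simp
  | succ s hs ih =>
    have hs' : (b : ℝ) ≤ s := by exact_mod_cast hs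
    push_cast at hY ⊢
    have ih := ih (by linarith)
    refine (hyp_succ_le_exp h0 h1 h2 (hb.trans hs')).trans ?_
    refine (mul_le_mul_of_nonneg_right ih (Real.exp_pos _).le).trans ?_
    rw [mul_assoc, ← Real.exp_add]
    refine mul_le_mul_of_nonneg_left (Real.exp_le_exp.2 ?_) (hyp_nonneg _ _ _ _)
    have hsq : ((s : ℝ) - hypMean K B m + 1) ^ 2 / (2 * hypMean K B m ^ 2)
        ≤ Y ^ 2 / (2 * hypMean K B m ^ 2) := by
      have : ((s : ℝ) - hypMean K B m + 1) ^ 2 ≤ Y ^ 2 :=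
        pow_le_pow_left₀ (by linarith) (by linarith) 2
      gcongr
    have hV := (binVar_pos h0 h1 h2).ne'
    have : -(((s : ℝ) - hypMean K B m) / binVar K B m)
        = -((((s : ℝ) + 1 - hypMean K B m) * ((s : ℝ) + 1 - hypMean K B m - 1)
          - ((s : ℝ) - hypMean K B m) * ((s : ℝ) - hypMean K B m - 1)) / (2 * binVar K B m)) := by
      field_simp; ring
    rw [neg_div, this]
    have e2 : ((s : ℝ) + 1 - b) * (Y ^ 2 / (2 * hypMean K B m ^ 2))
        = ((s : ℝ) - b) * (Y ^ 2 / (2 * hypMean K B m ^ 2)) + Y ^ 2 / (2 * hypMean K B m ^ 2) := by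
      ring
    rw [e2]
    have e3 : ∀ p q r w : ℝ, -((p - q) / w) = -((p - r) / w) + -((r - q) / w) := by
      intro p q r w; ring
    linarith [e3 (((s : ℝ) + 1 - hypMean K B m) * ((s : ℝ) + 1 - hypMean K B m - 1))
      (((b : ℝ) - hypMean K B m) * ((b : ℝ) - hypMean K B m - 1))
      (((s : ℝ) - hypMean K B m) * ((s : ℝ) - hypMean K B m - 1)) (2 * binVar K B m)]

/-- Upper bound of Gaussian order for the tail, `x` standard deviations above the mean (with an
allowance of `1` for rounding), uniformly while `x ^ 3` is at most the standard deviation. -/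
lemma hypTail_le (h0 : 1 ≤ K) (h1 : K ≤ m) (h2 : m ≤ B)
    (hp : hypMean K B m ≤ 2 * binVar K B m) {σ x : ℝ} (hσ : σ ^ 2 = binVar K B m)
    (hx : 2 ≤ x) (hxσ : x ^ 3 ≤ σ) {s : ℕ} (hs : σ * x - 1 ≤ s - hypMean K B m)
    (hs' : s - hypMean K B m ≤ σ * x) :
    hypTail K B m s ≤ 5 * Real.exp 3 * (Real.exp (-(x ^ 2 / 2)) / x) := by
  have a : 0 < hypMean K B m := hypMean_pos (B := B) h0 h1
  have hV := binVar_pos h0 h1 h2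
  have hVμ := binVar_le_mean (B := B) h0 h1
  have hσ4 : 4 * x ≤ σ := by
    have : x * 4 ≤ x * x ^ 2 := mul_le_mul_of_nonneg_left (by nlinarith) (by linarith)
    nlinarith
  have hσ8 : 8 ≤ σ := by linarith
  set b := ⌈hypMean K B m + σ⌉₊ with hb
  have b1 : hypMean K B m + σ ≤ b := Nat.le_ceil _
  have b2 : (b : ℝ) < hypMean K B m + σ + 1 := Nat.ceil_lt_add_one (by linarith)
  have hbs : b ≤ s := by
    have : σ * 2 ≤ σ * x := mul_le_mul_of_nonneg_left hx (by linarith)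
    exact Nat.ceil_le.2 (by linarith)
  have hbs' : (b : ℝ) ≤ s := by exact_mod_cast hbs
  have k1 : hyp K B m b ≤ 1 / σ := by
    rw [le_div_iff₀ (by linarith)]
    refine le_trans ?_ (hyp_mul_le_one h0 h1 h2 (b := b) (by linarith))
    rw [mul_comm]
    exact mul_le_mul_of_nonneg_right (by linarith) (hyp_nonneg _ _ _ _)
  have k2 := hyp_le_exp_of_le h0 h1 h2 (b := b) (s := s) (by linarith) hbs hs'
  have k3 := hypTail_mul_le h0 h1 h2 (s := s) (by linarith)
  set μ := hypMean K B m
  set V := binVar K B m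
  have hx0 : 0 < x := by linarith
  have hσ0 : 0 < σ := by linarith
  have hσx : 16 ≤ σ * x := by nlinarith
  -- the exponent is `- x ^ 2 / 2` up to a bounded error
  have E1 : (σ * x - 1) * (σ * x - 2) ≤ (s - μ) * (s - μ - 1) := by
    apply mul_le_mul <;> linarith
  have E2 : (b - μ) * (b - μ - 1) ≤ (σ + 1) * σ := by
    apply mul_le_mul <;> linarith
  have E3 : ((s : ℝ) - b) * ((σ * x) ^ 2 / (2 * μ ^ 2)) ≤ 1 / 2 := by
    have : (σ * x) ^ 2 / (2 * μ ^ 2) ≤ (σ * x) ^ 2 / (2 * V ^ 2) := by gcongr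
    calc ((s : ℝ) - b) * ((σ * x) ^ 2 / (2 * μ ^ 2))
        ≤ (σ * x) * ((σ * x) ^ 2 / (2 * V ^ 2)) := by
          apply mul_le_mul _ this (by positivity) (by positivity)
          linarith
      _ = x ^ 3 / (2 * σ) := by rw [← hσ]; field_simp
      _ ≤ 1 / 2 := by
          rw [div_le_div_iff₀ (by positivity) (by norm_num)]; linarith
  have E4 : -(((s - μ) * (s - μ - 1) - (b - μ) * (b - μ - 1)) / (2 * V))
      ≤ -(x ^ 2 / 2) + 5 / 2 := by
    have : x ^ 2 / 2 - 5 / 2 ≤ ((s - μ) * (s - μ - 1) - (b - μ) * (b - μ - 1)) / (2 * V) := by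
      rw [le_div_iff₀ (by linarith), ← hσ]
      have q1 : σ * (4 * x) ≤ σ * σ := mul_le_mul_of_nonneg_left hσ4 hσ0.le
      have q2 : σ * 8 ≤ σ * σ := mul_le_mul_of_nonneg_left hσ8 hσ0.le
      linarith
    linarith
  have k4 : hyp K B m s ≤ (1 / σ) * (Real.exp 3 * Real.exp (-(x ^ 2 / 2))) := by
    refine k2.trans (mul_le_mul k1 ?_ (Real.exp_pos _).le (by positivity))
    rw [← Real.exp_add, Real.exp_le_exp]
    linarith
  have hgap : σ * x / 2 ≤ s - μ := by linarith
  have k5 : hypTail K B m s ≤ (5 * σ / x) * hyp K B m s := by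
    have hpos : 0 < (s : ℝ) - μ := by linarith
    refine le_of_mul_le_mul_left (k3.trans ?_) hpos
    rw [← mul_assoc]
    refine mul_le_mul_of_nonneg_right ?_ (hyp_nonneg _ _ _ _)
    have h5 : 2 * σ ^ 2 ≤ (s - μ) * (4 * σ / x) := by
      calc 2 * σ ^ 2 = (σ * x / 2) * (4 * σ / x) := by field_simp; ring
        _ ≤ _ := mul_le_mul_of_nonneg_right hgap (by positivity)
    have h6 : (s : ℝ) - μ ≤ (s - μ) * (σ / x) := by
      have : 1 ≤ σ / x := by rw [le_div_iff₀ hx0]; linarith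
      exact le_mul_of_one_le_right hpos.le this
    calc (s : ℝ) = (s - μ) + μ := by ring
      _ ≤ (s - μ) * (σ / x) + (s - μ) * (4 * σ / x) := by linarith
      _ = _ := by ring
  calc hypTail K B m s ≤ (5 * σ / x) * hyp K B m s := k5
    _ ≤ (5 * σ / x) * ((1 / σ) * (Real.exp 3 * Real.exp (-(x ^ 2 / 2)))) := by gcongr
    _ = _ := by field_simp

end TailBounds

/-! ### The hypergeometric distribution: lower bound for the tail -/

section TailLowerBounds

variable {K B m : ℕ}

lemma exp_le_one_sub {u : ℝ} (hu : |u| ≤ 1 / 2) : Real.exp (-u - 2 * u ^ 2) ≤ 1 - u := by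
  have h := Real.abs_log_sub_add_sum_range_le (x := u) (by linarith) 1
  have hu' := abs_le.1 hu
  have h1 : |u| ^ 2 / (1 - |u|) ≤ 2 * u ^ 2 := by
    rw [sq_abs, div_le_iff₀ (by linarith)]
    nlinarith [sq_nonneg u]
  simp only [range_one, sum_singleton, zero_add, pow_one, Nat.cast_zero, div_one,
    Nat.reduceAdd] at h
  have h2 := (abs_le.1 (h.trans h1)).1
  calc _ ≤ Real.exp (Real.log (1 - u)) := Real.exp_le_exp.2 (by linarith)
    _ = _ := Real.exp_log (by linarith)

/-- Some weight within two standard deviations of the mean is at least of the order of the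
reciprocal of the standard deviation, by Chebyshev's inequality. -/
lemma exists_le_hyp (h0 : 2 ≤ K) (h1 : K ≤ m) (h2 : m ≤ B) {σ : ℝ} (hσ : 1 ≤ σ)
    (hσV : σ ^ 2 = binVar K B m) :
    ∃ a : ℕ, |(a : ℝ) - hypMean K B m| ≤ 2 * σ ∧ 1 / (8 * σ) ≤ hyp K B m a := by
  by_contra! hcon
  set μ := hypMean K B m
  set P : ℕ → Prop := fun i => |(i : ℝ) - μ| ≤ 2 * σ
  classical
  have hsplit := sum_filter_add_sum_filter_not (range (K + 1)) P (hyp K B m)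
  rw [sum_hyp h1 h2] at hsplit
  have far : ∑ i ∈ range (K + 1) with ¬ P i, hyp K B m i ≤ 1 / 4 := by
    have c : (4 * σ ^ 2) * ∑ i ∈ range (K + 1) with ¬ P i, hyp K B m i ≤ σ ^ 2 := by
      refine le_trans ?_ ((sum_sq_sub_hypMean_le h0 h1 h2).trans hσV.ge)
      rw [mul_sum]
      refine le_trans (sum_le_sum fun i hi => ?_)
        (sum_le_sum_of_subset_of_nonneg (filter_subset (fun i => ¬ P i) _)
          fun i _ _ => mul_nonneg (sq_nonneg _) (hyp_nonneg _ _ _ _))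
      refine mul_le_mul_of_nonneg_right ?_ (hyp_nonneg _ _ _ _)
      have := not_le.1 (mem_filter.1 hi).2
      rw [← sq_abs ((i : ℝ) - μ)]
      nlinarith
    have : 0 < σ ^ 2 := by positivity
    nlinarith
  have near : ∑ i ∈ range (K + 1) with P i, hyp K B m i ≤ 5 / 8 := by
    have c1 : (#(filter P (range (K + 1))) : ℝ) ≤ 5 * σ := by
      have hsub : filter P (range (K + 1)) ⊆ Icc ⌈μ - 2 * σ⌉₊ ⌊μ + 2 * σ⌋₊ := by
        intro i hi
        have hi := abs_le.1 (mem_filter.1 hi).2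
        rw [mem_Icc]
        exact ⟨Nat.ceil_le.2 (by linarith), Nat.le_floor (by linarith)⟩
      rcases (filter P (range (K + 1))).eq_empty_or_nonempty with he | ⟨i, hi⟩
      · rw [he]; simp; linarith
      have hi := mem_Icc.1 (hsub hi)
      have hμ0 : 0 < μ := hypMean_pos (by omega) h1
      calc (#(filter P (range (K + 1))) : ℝ) ≤ #(Icc ⌈μ - 2 * σ⌉₊ ⌊μ + 2 * σ⌋₊) := by
            exact_mod_cast card_le_card hsub
        _ = (⌊μ + 2 * σ⌋₊ : ℝ) + 1 - ⌈μ - 2 * σ⌉₊ := by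
            rw [Nat.card_Icc, Nat.cast_sub (by omega)]; push_cast; ring
        _ ≤ (μ + 2 * σ) + 1 - (μ - 2 * σ) := by
            have := Nat.floor_le (a := μ + 2 * σ) (by linarith)
            have := Nat.le_ceil (μ - 2 * σ)
            linarith
        _ ≤ 5 * σ := by linarith
    calc ∑ i ∈ range (K + 1) with P i, hyp K B m i
        ≤ ∑ i ∈ range (K + 1) with P i, 1 / (8 * σ) :=
          sum_le_sum fun i hi => (hcon i (mem_filter.1 hi).2).le
      _ = #(filter P (range (K + 1))) * (1 / (8 * σ)) := by rw [sum_const, nsmul_eq_mul]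
      _ ≤ 5 * σ * (1 / (8 * σ)) := by gcongr
      _ = 5 / 8 := by field_simp
  linarith

/-- The ratio of consecutive weights is at least that of a Gaussian density, up to a factor with
a second-order exponent. -/
lemma hyp_succ_ge_exp (h0 : 1 ≤ K) (h1 : K ≤ m) (h2 : m ≤ B) {i : ℕ} {Y ρ : ℝ} (hρ : 1 ≤ ρ)
    (hY : |(i : ℝ) - hypMean K B m| ≤ Y) (hYV : Y ≤ binVar K B m / 2)
    (hD2 : ρ * binVar K B m ≤ m - hypMean K B m)
    (hD4 : ρ * binVar K B m ≤ B - m + hypMean K B m) :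
    hyp K B m i * Real.exp (-(((i : ℝ) - hypMean K B m) / binVar K B m)
        - (2 * Y / (ρ * binVar K B m) + 2 / binVar K B m + 4 * Y ^ 2 / binVar K B m ^ 2))
      ≤ hyp K B m (i + 1) := by
  have hVi := binVar_inv h0 h1 h2
  have hV := binVar_pos h0 h1 h2
  have hV1 := binVar_le_left h0 h1 h2
  have hV3 := binVar_le_mean (B := B) h0 h1
  have f := hypMean_factors (B := B) (m := m) h0
  have g0 := hyp_nonneg K B m i
  have g1 := hyp_nonneg K B m (i + 1)
  have hY' := abs_le.1 hY
  have hm : (K : ℝ) ≤ m := by exact_mod_cast h1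
  have hKi : (i : ℝ) < K := by linarith
  have hKi' : i < K := by exact_mod_cast hKi
  have e := hyp_succ (K := K) (B := B) (m := m) (i := i) (by omega)
  set μ := hypMean K B m
  set V := binVar K B m
  set y := (i : ℝ) - μ with hy
  set D1 := (K : ℝ) - μ with hD1d
  set D2 := (m : ℝ) - μ with hD2d
  set D4 := (B : ℝ) - m + μ with hD4d
  have hρV : V ≤ ρ * V := le_mul_of_one_le_left hV.le hρ
  have p1 : 0 < D1 := by linarith
  have p2 : 0 < D2 := by linarith
  have p3 : 0 < μ := by linarith
  have p4 : 0 < D4 := by linarith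
  have hYnn : 0 ≤ Y := (abs_nonneg _).trans hY
  have u1 : |y / D1| ≤ Y / V := by
    rw [abs_div, abs_of_pos p1]; gcongr
  have u2 : |y / D2| ≤ Y / V := by
    rw [abs_div, abs_of_pos p2]; gcongr; linarith
  have hYV2 : Y / V ≤ 1 / 2 := by rw [div_le_iff₀ hV]; linarith
  have c1 : D1 * Real.exp (-(y / D1) - 2 * (y / D1) ^ 2) ≤ K - i := by
    refine (mul_le_mul_of_nonneg_left (exp_le_one_sub (u1.trans hYV2)) p1.le).trans (le_of_eq ?_)
    rw [mul_sub, mul_div_cancel₀ _ p1.ne', hy, hD1d]; ring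
  have c2 : D2 * Real.exp (-(y / D2) - 2 * (y / D2) ^ 2) ≤ m - i := by
    refine (mul_le_mul_of_nonneg_left (exp_le_one_sub (u2.trans hYV2)) p2.le).trans (le_of_eq ?_)
    rw [mul_sub, mul_div_cancel₀ _ p2.ne', hy, hD2d]; ring
  have c3 : (i : ℝ) + 1 ≤ μ * Real.exp ((y + 1) / μ) := by
    refine le_trans (le_of_eq ?_)
      (mul_le_mul_of_nonneg_left (Real.add_one_le_exp ((y + 1) / μ)) p3.le)
    rw [mul_add, mul_div_cancel₀ _ p3.ne', hy]; ring
  have c4 : (B : ℝ) - m + i + 1 ≤ D4 * Real.exp ((y + 1) / D4) := by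
    refine le_trans (le_of_eq ?_)
      (mul_le_mul_of_nonneg_left (Real.add_one_le_exp ((y + 1) / D4)) p4.le)
    rw [mul_add, mul_div_cancel₀ _ p4.ne', hy, hD4d]; ring
  set x1 := -(y / D1) - 2 * (y / D1) ^ 2
  set x2 := -(y / D2) - 2 * (y / D2) ^ 2
  have c5 : hyp K B m i * Real.exp (x1 + x2)
      ≤ hyp K B m (i + 1) * Real.exp ((y + 1) / μ + (y + 1) / D4) := by
    rw [Real.exp_add, Real.exp_add]
    have p : 0 < D1 * D2 := by positivity
    refine le_of_mul_le_mul_right ?_ p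
    have hB : (m : ℝ) ≤ B := by exact_mod_cast h2
    have hi0 : (0 : ℝ) ≤ i := by positivity
    calc hyp K B m i * (Real.exp x1 * Real.exp x2) * (D1 * D2)
        = hyp K B m i * ((D1 * Real.exp x1) * (D2 * Real.exp x2)) := by ring
      _ ≤ hyp K B m i * (((K : ℝ) - i) * (m - i)) := by
          refine mul_le_mul_of_nonneg_left ?_ g0
          exact mul_le_mul c1 c2 (by positivity) (by linarith)
      _ = hyp K B m (i + 1) * ((i + 1) * (B - m + i + 1)) := e.symm
      _ ≤ hyp K B m (i + 1) * ((μ * Real.exp ((y + 1) / μ)) * (D4 * Real.exp ((y + 1) / D4))) := by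
          refine mul_le_mul_of_nonneg_left ?_ g1
          exact mul_le_mul c3 c4 (by linarith) (by positivity)
      _ = _ := by rw [f]; ring
  have c6 : hyp K B m i * Real.exp (x1 + x2 - ((y + 1) / μ + (y + 1) / D4))
      ≤ hyp K B m (i + 1) := by
    rw [Real.exp_sub, ← mul_div_assoc, div_le_iff₀ (Real.exp_pos _)]; exact c5
  refine le_trans (mul_le_mul_of_nonneg_left (Real.exp_le_exp.2 ?_) g0) c6
  have hyV : y / V = y / D1 + y / μ := by
    rw [div_eq_mul_one_div y V, hVi]; ring
  have v2 : y / D2 ≤ Y / (ρ * V) :=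
    calc y / D2 ≤ Y / D2 := div_le_div_of_nonneg_right hY'.2 p2.le
      _ ≤ _ := by gcongr
  have v4 : y / D4 ≤ Y / (ρ * V) :=
    calc y / D4 ≤ Y / D4 := div_le_div_of_nonneg_right hY'.2 p4.le
      _ ≤ _ := by gcongr
  have w3 : 1 / μ ≤ 1 / V := by gcongr
  have w4 : 1 / D4 ≤ 1 / V := by gcongr; linarith
  have s1 : (y / D1) ^ 2 ≤ Y ^ 2 / V ^ 2 := by
    rw [← div_pow]; exact sq_le_sq.2 (u1.trans (le_abs_self _))
  have s2 : (y / D2) ^ 2 ≤ Y ^ 2 / V ^ 2 := by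
    rw [← div_pow]; exact sq_le_sq.2 (u2.trans (le_abs_self _))
  have r1 : (y + 1) / μ = y / μ + 1 / μ := add_div _ _ _
  have r2 : (y + 1) / D4 = y / D4 + 1 / D4 := add_div _ _ _
  have r3 : 2 * Y / (ρ * V) = 2 * (Y / (ρ * V)) := mul_div_assoc _ _ _
  have r4 : 2 / V = 2 * (1 / V) := by ring
  have r5 : 4 * Y ^ 2 / V ^ 2 = 4 * (Y ^ 2 / V ^ 2) := mul_div_assoc _ _ _
  rw [hyV, r1, r2, r3, r4, r5]
  simp only [x1, x2]
  linarith

lemma hyp_ge_exp_of_le (h0 : 1 ≤ K) (h1 : K ≤ m) (h2 : m ≤ B) {a e : ℕ} (hae : a ≤ e)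
    {Y ρ : ℝ} (hρ : 1 ≤ ρ) (ha : -Y ≤ a - hypMean K B m) (he : (e : ℝ) - hypMean K B m ≤ Y)
    (hYV : Y ≤ binVar K B m / 2)
    (hD2 : ρ * binVar K B m ≤ m - hypMean K B m)
    (hD4 : ρ * binVar K B m ≤ B - m + hypMean K B m) :
    hyp K B m a *
      Real.exp (-((((e : ℝ) - hypMean K B m) * ((e : ℝ) - hypMean K B m - 1)
          - ((a : ℝ) - hypMean K B m) * ((a : ℝ) - hypMean K B m - 1)) / (2 * binVar K B m))
        - ((e : ℝ) - a) * (2 * Y / (ρ * binVar K B m) + 2 / binVar K B m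
          + 4 * Y ^ 2 / binVar K B m ^ 2)) ≤ hyp K B m e := by
  have hV := (binVar_pos h0 h1 h2).ne'
  set ε := 2 * Y / (ρ * binVar K B m) + 2 / binVar K B m + 4 * Y ^ 2 / binVar K B m ^ 2 with hε
  induction e, hae using Nat.le_induction with
  | base => simp
  | succ e hae ih =>
    have hae' : (a : ℝ) ≤ e := by exact_mod_cast hae
    push_cast at he ⊢
    have ih := ih (by linarith)
    have st := hyp_succ_ge_exp h0 h1 h2 (i := e) hρ
      (abs_le.2 ⟨by linarith, by linarith⟩) hYV hD2 hD4
    rw [← hε] at st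
    refine le_trans (le_trans (le_of_eq ?_) (mul_le_mul_of_nonneg_right ih (Real.exp_pos _).le)) st
    rw [mul_assoc, ← Real.exp_add]
    congr 2
    field_simp
    ring

/-- Lower bound of Gaussian order for the tail, `x` standard deviations above the mean. -/
lemma le_hypTail (h0 : 2 ≤ K) (h1 : K ≤ m) (h2 : m ≤ B) {σ x ρ : ℝ}
    (hσ : σ ^ 2 = binVar K B m) (hx : 2 ≤ x) (hxσ : x ^ 3 ≤ σ) (hρ : 1 ≤ ρ) (hxρ : x ^ 2 ≤ ρ)
    (hD2 : ρ * binVar K B m ≤ m - hypMean K B m)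
    (hD4 : ρ * binVar K B m ≤ B - m + hypMean K B m) {s : ℕ}
    (hs : σ * x ≤ s - hypMean K B m) (hs' : s - hypMean K B m ≤ σ * x + 1) :
    Real.exp (-91) / 8 * (Real.exp (-(x ^ 2 / 2)) / x) ≤ hypTail K B m s := by
  have hV := binVar_pos (by omega) h1 h2
  have hV1 := binVar_le_left (by omega) h1 h2
  have hx0 : 0 < x := by linarith
  have hσ4 : 4 * x ≤ σ := by
    have : x * 4 ≤ x * x ^ 2 := mul_le_mul_of_nonneg_left (by nlinarith) (by linarith)
    nlinarith
  have hσ0 : 0 < σ := by linarith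
  obtain ⟨a, ha, ha'⟩ := exists_le_hyp h0 h1 h2 (by linarith) hσ
  have ha := abs_le.1 ha
  -- the weights decrease by a bounded factor only over the next `σ / x` indices
  set w := ⌊σ / x⌋₊
  have w1 : (w : ℝ) ≤ σ / x := Nat.floor_le (by positivity)
  have w2 : σ / x < w + 1 := Nat.lt_floor_add_one _
  have hσx2 : σ * 2 ≤ σ * x := mul_le_mul_of_nonneg_left hx hσ0.le
  have hae : a ≤ s + w := by
    have : (a : ℝ) ≤ ((s + w : ℕ) : ℝ) := by
      push_cast
      have : (0 : ℝ) ≤ w := by positivity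
      linarith
    exact_mod_cast this
  have hσdx : 4 ≤ σ / x := by rw [le_div_iff₀ hx0]; exact hσ4
  have hdiv : σ / x ≤ σ / 2 := by gcongr
  have ye : ((s + w : ℕ) : ℝ) - hypMean K B m ≤ σ * (x + 2 / x) := by
    push_cast
    have : σ * (x + 2 / x) = σ * x + 2 * (σ / x) := by field_simp
    rw [this]; linarith
  have ye2 : ((s + w : ℕ) : ℝ) - hypMean K B m ≤ 2 * σ * x := by
    refine ye.trans ?_
    have : σ * (x + 2 / x) = σ * x + 2 * (σ / x) := by field_simp
    linarith
  have ye0 : 0 ≤ ((s + w : ℕ) : ℝ) - hypMean K B m := by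
    push_cast
    have : (0 : ℝ) ≤ w := by positivity
    have := mul_pos hσ0 hx0
    linarith
  have hYV : 2 * σ * x ≤ binVar K B m / 2 := by
    rw [← hσ]
    have := mul_le_mul_of_nonneg_left hσ4 hσ0.le
    linarith
  have k1 := hyp_ge_exp_of_le (by omega) h1 h2 hae (Y := 2 * σ * x) hρ (by linarith) ye2 hYV
    hD2 hD4
  set e := s + w with he
  have hse : (s : ℝ) ≤ e := by exact_mod_cast Nat.le_add_right s w
  have heK : e ≤ K := by
    have : (e : ℝ) ≤ K := by linarith
    exact_mod_cast this
  set μ := hypMean K B m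
  have tail : (σ / x) * hyp K B m e ≤ hypTail K B m s := by
    calc (σ / x) * hyp K B m e ≤ (#(Icc s e) : ℝ) * hyp K B m e := by
          refine mul_le_mul_of_nonneg_right ?_ (hyp_nonneg _ _ _ _)
          rw [Nat.card_Icc, show e + 1 - s = w + 1 by omega]; push_cast; exact w2.le
      _ ≤ ∑ i ∈ Icc s e, hyp K B m i := by
          rw [← nsmul_eq_mul]
          refine card_nsmul_le_sum _ _ _ fun i hi => ?_
          rw [mem_Icc] at hi
          have : (s : ℝ) ≤ i := by exact_mod_cast hi.1
          have := mul_pos hσ0 hx0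
          exact hyp_antitone (by omega) h1 h2 (by linarith) hi.2
      _ ≤ hypTail K B m s := by
          rw [hypTail, ← sum_filter]
          refine sum_le_sum_of_subset_of_nonneg (fun i hi => ?_) fun i _ _ => hyp_nonneg _ _ _ _
          simp only [mem_filter, Finset.mem_range, mem_Icc] at hi ⊢
          omega
  -- the exponent is `- x ^ 2 / 2` up to a bounded error
  have E1 : ((e : ℝ) - μ) * ((e : ℝ) - μ - 1) ≤ σ ^ 2 * (x ^ 2 + 5) := by
    calc ((e : ℝ) - μ) * ((e : ℝ) - μ - 1) ≤ ((e : ℝ) - μ) * ((e : ℝ) - μ) :=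
          mul_le_mul_of_nonneg_left (by linarith) ye0
      _ ≤ (σ * (x + 2 / x)) * (σ * (x + 2 / x)) := mul_le_mul ye ye ye0 (by positivity)
      _ = σ ^ 2 * (x ^ 2 + 4 + 4 / x ^ 2) := by field_simp; ring
      _ ≤ σ ^ 2 * (x ^ 2 + 5) := by
          have : 4 / x ^ 2 ≤ 1 := by rw [div_le_one (by positivity)]; nlinarith
          gcongr ?_ * ?_
          linarith
  have E2 : -(1 / 4) ≤ ((a : ℝ) - μ) * ((a : ℝ) - μ - 1) := by
    nlinarith [sq_nonneg ((a : ℝ) - μ - 1 / 2)]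
  have E3 : (((e : ℝ) - μ) * ((e : ℝ) - μ - 1) - ((a : ℝ) - μ) * ((a : ℝ) - μ - 1))
      / (2 * binVar K B m) ≤ x ^ 2 / 2 + 3 := by
    rw [div_le_iff₀ (by linarith), ← hσ]
    have : 1 ≤ σ ^ 2 := one_le_pow₀ (by linarith)
    linarith
  have E4 : ((e : ℝ) - a) * (2 * (2 * σ * x) / (ρ * binVar K B m) + 2 / binVar K B m
          + 4 * (2 * σ * x) ^ 2 / binVar K B m ^ 2) ≤ 88 := by
    have d1 : (e : ℝ) - a ≤ 4 * σ * x := by linarith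
    calc ((e : ℝ) - a) * (2 * (2 * σ * x) / (ρ * binVar K B m) + 2 / binVar K B m
          + 4 * (2 * σ * x) ^ 2 / binVar K B m ^ 2)
        ≤ (4 * σ * x) * (2 * (2 * σ * x) / (ρ * binVar K B m) + 2 / binVar K B m
          + 4 * (2 * σ * x) ^ 2 / binVar K B m ^ 2) :=
          mul_le_mul_of_nonneg_right d1 (by positivity)
      _ = 16 * (x ^ 2 / ρ) + 8 * (x / σ) + 64 * (x ^ 3 / σ) := by
          rw [← hσ]; field_simp; ring
      _ ≤ 16 * 1 + 8 * 1 + 64 * 1 := by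
          have t1 : x ^ 2 / ρ ≤ 1 := by rw [div_le_one (by linarith)]; exact hxρ
          have t2 : x / σ ≤ 1 := by rw [div_le_one hσ0]; linarith
          have t3 : x ^ 3 / σ ≤ 1 := by rw [div_le_one hσ0]; exact hxσ
          linarith
      _ = 88 := by norm_num
  have k2 : (1 / (8 * σ)) * (Real.exp (-91) * Real.exp (-(x ^ 2 / 2))) ≤ hyp K B m e := by
    refine le_trans (mul_le_mul ha' ?_ (by positivity) (hyp_nonneg _ _ _ _)) k1
    rw [← Real.exp_add, Real.exp_le_exp]
    linarith
  calc Real.exp (-91) / 8 * (Real.exp (-(x ^ 2 / 2)) / x)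
      = (σ / x) * ((1 / (8 * σ)) * (Real.exp (-91) * Real.exp (-(x ^ 2 / 2)))) := by field_simp
    _ ≤ (σ / x) * hyp K B m e := by gcongr
    _ ≤ _ := tail

end TailLowerBounds

/-! ### Two sets sharing one point -/

section Pairs

variable {ι : Type*} [DecidableEq ι]

lemma hits_insert {A : Finset ι} {e : ι} (he : e ∈ A) {M : Finset ι} (hM : e ∉ M) (s : ℕ) :
    hits A (s + 1) (insert e M) = hits (A.erase e) s M := by
  have h1 : insert e M ∩ A = insert e (M ∩ A.erase e) := by
    ext x
    simp only [mem_inter, mem_insert, mem_erase]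
    constructor
    · rintro ⟨rfl | h, h'⟩
      · exact Or.inl rfl
      · by_cases hx : x = e
        · exact Or.inl hx
        · exact Or.inr ⟨h, hx, h'⟩
    · rintro (rfl | h)
      · exact ⟨Or.inl rfl, he⟩
      · exact ⟨Or.inr h.1, h.2.2⟩
  have h2 : #(insert e M ∩ A) = #(M ∩ A.erase e) + 1 := by
    rw [h1, card_insert_of_notMem]
    simp
  simp only [hits, h2, Nat.add_le_add_iff_right]

lemma hits_erase {A : Finset ι} {e : ι} {M : Finset ι} (hM : e ∉ M) (s : ℕ) :
    hits A s M = hits (A.erase e) s M := by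
  have : M ∩ A = M ∩ A.erase e := by
    ext x
    simp only [mem_inter, mem_erase]
    exact ⟨fun h => ⟨h.1, fun hx => hM (hx ▸ h.1), h.2⟩, fun h => ⟨h.1, h.2.2⟩⟩
  simp only [hits, this]

/-- The joint upper tail for two sets of equal size that share exactly one point `e` is at most
the square of the marginal one, up to a factor that tends to `1` with the sampling density.
Conditionally on whether `e` is sampled the two events are negatively correlated; the case
`e ∈ M` has small probability and inflates the marginals by a bounded factor only. -/
lemma sliceMean_hits_mul_hits_le {E A B : Finset ι} {e : ι} (hA : A ⊆ E) (hB : B ⊆ E)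
    (hAB : A ∩ B = {e}) {K C m : ℕ} (hAK : #A = K + 1) (hBK : #B = K + 1)
    (hE : #E = K + 1 + C) (hKm : K ≤ m) (hmC : m < C)
    (hN : (K : ℝ) + 1 + C ≤ 2 * ((C : ℝ) - m)) (s : ℕ) :
    sliceMean E (m + 1) (fun M => hits A (s + 1) M * hits B (s + 1) M)
      ≤ (((m : ℝ) + 1) / #E * (((s : ℝ) + 1) / hypMean (K + 1) C (m + 1) + 2) ^ 2
          + 1 / (1 - ((m : ℝ) + 1) / #E)) * hypTail (K + 1) C (m + 1) (s + 1) ^ 2 := by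
  have heA : e ∈ A := (mem_inter.1 (hAB ▸ mem_singleton_self e : e ∈ A ∩ B)).1
  have heB : e ∈ B := (mem_inter.1 (hAB ▸ mem_singleton_self e : e ∈ A ∩ B)).2
  have heE := hA heA
  have cE : #(E.erase e) = K + C := by rw [card_erase_of_mem heE]; omega
  have cA : #(A.erase e) = K := by rw [card_erase_of_mem heA]; omega
  have cB : #(B.erase e) = K := by rw [card_erase_of_mem heB]; omega
  have sA : A.erase e ⊆ E.erase e := erase_subset_erase _ hA
  have sB : B.erase e ⊆ E.erase e := erase_subset_erase _ hB
  have dAB : Disjoint (A.erase e) (B.erase e) := by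
    rw [disjoint_left]
    intro x hx hx'
    rw [mem_erase] at hx hx'
    have : x ∈ A ∩ B := mem_inter.2 ⟨hx.2, hx'.2⟩
    rw [hAB, mem_singleton] at this
    exact hx.1 this
  set p : ℝ := ((m : ℝ) + 1) / #E with hp
  have hEpos : (0 : ℝ) < #E := by rw [hE]; positivity
  have hp0 : 0 ≤ p := by positivity
  have hp1 : p < 1 := by
    rw [hp, div_lt_one hEpos, hE]
    have : (m : ℝ) < C := by exact_mod_cast hmC
    push_cast
    have : (0 : ℝ) ≤ K := by positivity
    linarith
  have hc : (0 : ℝ) < (#E).choose (m + 1) := by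
    exact_mod_cast Nat.choose_pos (by omega)
  have q1 : ((#(E.erase e)).choose m : ℝ) = p * (#E).choose (m + 1) := by
    have h : ((K + C : ℕ) + 1 : ℝ) * (K + C).choose m
        = (K + C + 1).choose (m + 1) * ((m : ℝ) + 1) := by
      exact_mod_cast Nat.add_one_mul_choose_eq (K + C) m
    have hE' : #E = K + C + 1 := by omega
    rw [cE, hp, hE', div_mul_eq_mul_div, eq_div_iff (by positivity)]
    push_cast at h ⊢
    linarith
  have q2 : ((#(E.erase e)).choose (m + 1) : ℝ) = (1 - p) * (#E).choose (m + 1) := by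
    have h : ((#E).choose (m + 1) : ℝ)
        = (#(E.erase e)).choose m + (#(E.erase e)).choose (m + 1) := by
      rw [show #E = #(E.erase e) + 1 by omega]
      exact_mod_cast Nat.choose_succ_succ _ _
    rw [q1] at h
    linarith
  -- conditioning on `e ∈ M`
  have cond : ∀ f : Finset ι → ℝ, sliceMean E (m + 1) f
      = (1 - p) * sliceMean (E.erase e) (m + 1) f
        + p * sliceMean (E.erase e) m (fun M => f (insert e M)) := by
    intro f
    have h := sum_powersetCard_succ_erase heE m f
    rw [sum_powersetCard_eq, sum_powersetCard_eq, sum_powersetCard_eq, q1, q2] at h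
    refine mul_left_cancel₀ hc.ne' ?_
    rw [h]; ring
  have notMem : ∀ j, ∀ M ∈ (E.erase e).powersetCard j, e ∉ M := fun j M hM h =>
    notMem_erase e E ((mem_powersetCard.1 hM).1 h)
  set a0 := hypTail K C (m + 1) (s + 1) with ha0
  set a1 := hypTail K C m s with ha1
  set q := hypTail (K + 1) C (m + 1) (s + 1) with hq
  have tA0 : sliceMean (E.erase e) (m + 1) (hits (A.erase e) (s + 1)) = a0 := by
    rw [sliceMean_hits sA (by omega), cA, cE, Nat.add_sub_cancel_left]
  have tB0 : sliceMean (E.erase e) (m + 1) (hits (B.erase e) (s + 1)) = a0 := by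
    rw [sliceMean_hits sB (by omega), cB, cE, Nat.add_sub_cancel_left]
  have tA1 : sliceMean (E.erase e) m (hits (A.erase e) s) = a1 := by
    rw [sliceMean_hits sA (by omega), cA, cE, Nat.add_sub_cancel_left]
  have tB1 : sliceMean (E.erase e) m (hits (B.erase e) s) = a1 := by
    rw [sliceMean_hits sB (by omega), cB, cE, Nat.add_sub_cancel_left]
  have hqe : q = (1 - p) * a0 + p * a1 := by
    have h := cond (hits A (s + 1))
    rw [sliceMean_hits hA (by omega), hAK, hE, Nat.add_sub_cancel_left, ← hq,
      sliceMean_congr fun M hM => hits_erase (notMem _ M hM) (s + 1),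
      sliceMean_congr fun M hM => hits_insert heA (notMem _ M hM) s, tA0, tA1] at h
    exact h
  have hJ := cond (fun M => hits A (s + 1) M * hits B (s + 1) M)
  have j0 : sliceMean (E.erase e) (m + 1) (fun M => hits A (s + 1) M * hits B (s + 1) M)
      ≤ a0 * a0 := by
    have := sliceMean_hits_mul_le (m := m + 1) sA dAB (by omega) (by omega) (s + 1) (s + 1)
    rw [tA0, tB0] at this
    refine le_trans (le_of_eq (sliceMean_congr fun M hM => ?_)) this
    rw [hits_erase (notMem _ M hM) (s + 1), hits_erase (A := B) (notMem _ M hM) (s + 1)]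
  have j1 : sliceMean (E.erase e) m
      (fun M => hits A (s + 1) (insert e M) * hits B (s + 1) (insert e M)) ≤ a1 * a1 := by
    have := sliceMean_hits_mul_le (m := m) sA dAB (by omega) (by omega) s s
    rw [tA1, tB1] at this
    refine le_trans (le_of_eq (sliceMean_congr fun M hM => ?_)) this
    rw [hits_insert heA (notMem _ M hM) s, hits_insert heB (notMem _ M hM) s]
  have hR := hypTail_le_mul_hypTail_succ (s := s) hKm hN
  rw [← ha1, ← hq] at hR
  set R := ((s : ℝ) + 1) / hypMean (K + 1) C (m + 1) + 2
  have a0n : 0 ≤ a0 := hypTail_nonneg _ _ _ _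
  have a1n : 0 ≤ a1 := hypTail_nonneg _ _ _ _
  have r1 : a1 * a1 ≤ R ^ 2 * q ^ 2 := by
    calc a1 * a1 ≤ (R * q) * (R * q) := mul_le_mul hR hR a1n (a1n.trans hR)
      _ = _ := by ring
  have hp1' : 0 < 1 - p := by linarith
  have r0 : (1 - p) * (a0 * a0) ≤ 1 / (1 - p) * q ^ 2 := by
    have : (1 - p) * a0 ≤ q := by rw [hqe]; linarith [mul_nonneg hp0 a1n]
    rw [div_mul_eq_mul_div, one_mul, le_div_iff₀ hp1']
    calc (1 - p) * (a0 * a0) * (1 - p) = ((1 - p) * a0) * ((1 - p) * a0) := by ring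
      _ ≤ q * q := mul_le_mul this this (by positivity) (le_trans (by positivity) this)
      _ = _ := by ring
  rw [hJ]
  have r2 := mul_le_mul_of_nonneg_left j0 hp1'.le
  have r3 := mul_le_mul_of_nonneg_left (j1.trans r1) hp0
  linarith

end Pairs

/-! ### The degrees of a random graph as hypergeometric variables -/

section Graphs

/-- The possible edges of a graph on `Fin n`. -/
def allEdges (n : ℕ) : Finset (Sym2 (Fin n)) := {e | ¬ e.IsDiag}

/-- The possible edges at the vertex `v`. -/
def starEdges {n : ℕ} (v : Fin n) : Finset (Sym2 (Fin n)) := {e ∈ allEdges n | v ∈ e}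

variable {n : ℕ}

lemma star_subset (v : Fin n) : starEdges v ⊆ allEdges n := filter_subset _ _

lemma edgeFinset_top_eq [Fintype (⊤ : SimpleGraph (Fin n)).edgeSet] :
    (⊤ : SimpleGraph (Fin n)).edgeFinset = allEdges n := by
  ext e
  simp [allEdges]

lemma incidenceFinset_top_eq (v : Fin n) [Fintype ((⊤ : SimpleGraph (Fin n)).neighborSet v)] :
    (⊤ : SimpleGraph (Fin n)).incidenceFinset v = starEdges v := by
  ext e
  simp [starEdges, allEdges, SimpleGraph.incidenceSet]

lemma card_allEdges : #(allEdges n) = n.choose 2 := by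
  rw [← edgeFinset_top_eq, SimpleGraph.card_edgeFinset_top_eq_card_choose_two, Fintype.card_fin]

lemma card_star (v : Fin n) : #(starEdges v) = n - 1 := by
  rw [← incidenceFinset_top_eq, SimpleGraph.card_incidenceFinset_eq_degree,
    SimpleGraph.complete_graph_degree, Fintype.card_fin]

lemma star_inter_star {u v : Fin n} (h : u ≠ v) : starEdges u ∩ starEdges v = {s(u, v)} := by
  ext e
  simp only [starEdges, allEdges, mem_inter, mem_filter, Finset.mem_univ, true_and, mem_singleton]
  constructor
  · rintro ⟨⟨_, hu⟩, _, hv⟩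
    exact ((Sym2.mem_and_mem_iff h).1 ⟨hu, hv⟩)
  · rintro rfl
    simp [h]

lemma edgeFinset_fromEdgeSet_eq {M : Finset (Sym2 (Fin n))} (hM : M ⊆ allEdges n)
    [Fintype (SimpleGraph.fromEdgeSet (M : Set (Sym2 (Fin n)))).edgeSet] :
    (SimpleGraph.fromEdgeSet (M : Set (Sym2 (Fin n)))).edgeFinset = M := by
  ext e
  simp only [SimpleGraph.mem_edgeFinset, SimpleGraph.edgeSet_fromEdgeSet, Set.mem_sdiff,
    SetLike.mem_coe]
  refine ⟨fun h => h.1, fun h => ⟨h, ?_⟩⟩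
  have := hM h
  simpa [allEdges] using this

lemma vertexDegree_fromEdgeSet {M : Finset (Sym2 (Fin n))} (hM : M ⊆ allEdges n) (v : Fin n) :
    vertexDegree (SimpleGraph.fromEdgeSet (M : Set (Sym2 (Fin n)))) v = #(M ∩ starEdges v) := by
  classical
  unfold vertexDegree
  rw [← SimpleGraph.card_incidenceFinset_eq_degree, SimpleGraph.incidenceFinset_eq_filter,
    edgeFinset_fromEdgeSet_eq hM]
  congr 1
  ext e
  simp only [mem_filter, mem_inter, starEdges]
  exact ⟨fun h => ⟨h.1, hM h.1, h.2⟩, fun h => ⟨h.1, h.2.2⟩⟩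

lemma le_maxDegree_iff (hn : 1 ≤ n) (G : SimpleGraph (Fin n)) (t : ℝ) :
    t ≤ maxDegree G ↔ ∃ v, t ≤ vertexDegree G v := by
  classical
  have : Nonempty (Fin n) := ⟨⟨0, hn⟩⟩
  unfold maxDegree vertexDegree
  constructor
  · intro h
    obtain ⟨v, hv⟩ := G.exists_maximal_degree_vertex
    refine ⟨v, ?_⟩
    convert h using 2
    rw [← hv]
  · rintro ⟨v, hv⟩
    refine hv.trans ?_
    exact_mod_cast G.degree_le_maxDegree v

open Classical in
lemma nullProb_eq_sliceMean (n m : ℕ) (A : SimpleGraph (Fin n) → Prop) :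
    nullProb n m A = sliceMean (allEdges n) m
      (fun M => if A (SimpleGraph.fromEdgeSet (M : Set (Sym2 (Fin n)))) then 1 else 0) := by
  unfold nullProb sliceMean
  refine expect_nbij' (fun G => G.edgeFinset)
    (fun M => SimpleGraph.fromEdgeSet (M : Set (Sym2 (Fin n)))) ?_ ?_ ?_ ?_ ?_
  · intro G hG
    rw [mem_powersetCard]
    refine ⟨?_, (mem_filter.1 hG).2⟩
    intro e he
    have := G.not_isDiag_of_mem_edgeFinset he
    simpa [allEdges] using this
  · intro M hM
    rw [mem_powersetCard] at hM
    rw [mem_filter]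
    refine ⟨Finset.mem_univ _, ?_⟩
    rw [← hM.2]
    congr 1
    convert edgeFinset_fromEdgeSet_eq hM.1
  · intro G _
    simp
  · intro M hM
    convert edgeFinset_fromEdgeSet_eq (mem_powersetCard.1 hM).1
  · intro G _
    simp

lemma le_vertexDegree_iff {M : Finset (Sym2 (Fin n))} (hM : M ⊆ allEdges n) (v : Fin n) (t : ℝ) :
    t ≤ vertexDegree (SimpleGraph.fromEdgeSet (M : Set (Sym2 (Fin n)))) v
      ↔ ⌈t⌉₊ ≤ #(M ∩ starEdges v) := by
  rw [vertexDegree_fromEdgeSet hM, Nat.ceil_le]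

/-- The probability that a given vertex has degree at least `s` in `G(n, m)`. -/
noncomputable def degreeTail (n m s : ℕ) : ℝ := hypTail (n - 1) (n.choose 2 - (n - 1)) m s

lemma sliceMean_hits_star (v : Fin n) {m : ℕ} (hm : n - 1 ≤ m) (s : ℕ) :
    sliceMean (allEdges n) m (hits (starEdges v) s) = degreeTail n m s := by
  rw [sliceMean_hits (star_subset v) (by rwa [card_star]), card_star, card_allEdges, degreeTail]

lemma degreeTail_antitone (n m : ℕ) {s s' : ℕ} (h : s ≤ s') :
    degreeTail n m s' ≤ degreeTail n m s := by
  unfold degreeTail hypTail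
  refine sum_le_sum fun i _ => ?_
  have := hyp_nonneg (n - 1) (n.choose 2 - (n - 1)) m i
  split_ifs <;> first | omega | exact le_rfl

lemma nullProb_nonneg (n m : ℕ) (A : SimpleGraph (Fin n) → Prop) : 0 ≤ nullProb n m A := by
  unfold nullProb
  exact expect_nonneg fun _ _ => by split_ifs <;> norm_num

lemma nullProb_le_one (n m : ℕ) (hm : m ≤ n.choose 2) (A : SimpleGraph (Fin n) → Prop) :
    nullProb n m A ≤ 1 := by
  classical
  rw [nullProb_eq_sliceMean, sliceMean]
  refine expect_le ?_ fun _ _ => by split_ifs <;> norm_num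
  rw [powersetCard_nonempty, card_allEdges]
  exact hm

lemma nullProb_le_maxDegree_le (hn : 1 ≤ n) {m : ℕ} (hm : n - 1 ≤ m) (t : ℝ) :
    nullProb n m (fun G => t ≤ (maxDegree G : ℝ)) ≤ n * degreeTail n m ⌈t⌉₊ := by
  classical
  rw [nullProb_eq_sliceMean]
  calc _ ≤ sliceMean (allEdges n) m (fun M => ∑ v : Fin n, hits (starEdges v) ⌈t⌉₊ M) := by
        refine sliceMean_mono fun M hM => ?_
        have hM := (mem_powersetCard.1 hM).1
        split_ifs with h
        · obtain ⟨v, hv⟩ := (le_maxDegree_iff hn _ _).1 h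
          rw [le_vertexDegree_iff hM] at hv
          calc (1 : ℝ) = hits (starEdges v) ⌈t⌉₊ M := by rw [hits, if_pos hv]
            _ ≤ _ := single_le_sum (f := fun v => hits (starEdges v) ⌈t⌉₊ M)
                (fun v _ => hits_nonneg _ _ _) (Finset.mem_univ v)
        · exact sum_nonneg fun v _ => hits_nonneg _ _ _
    _ = _ := by
        rw [sliceMean_sum, sum_congr rfl fun v _ => sliceMean_hits_star v hm _]
        simp

/-- In the planted star model, a vertex other than the hub exceeds a threshold with at most the
probability of the null model at a threshold lower by `1`: at most one edge of the star meets it,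
and the other edges are dominated by a uniform sample of `m` edges. -/
lemma plantedProb_sub_mem (hn : 1 ≤ n) {m k : ℕ} (hm : n - 1 ≤ m) (hmN : m ≤ n.choose 2)
    (hk : k ≤ n - 1) (t : ℝ) :
    plantedProb n m k (fun _ G => t ≤ (maxDegree G : ℝ))
      - plantedProb n m k (fun v G => t ≤ (vertexDegree G v : ℝ))
      ∈ Set.Icc 0 (n * degreeTail n m (⌈t⌉₊ - 1)) := by
  classical
  have hne : Nonempty (Fin n) := ⟨⟨0, hn⟩⟩
  unfold plantedProb
  simp only [← expect_sub_distrib]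
  have hS1 : ∀ v : Fin n,
      (((⊤ : SimpleGraph (Fin n)).incidenceFinset v).powersetCard k).Nonempty := by
    intro v
    rw [powersetCard_nonempty, incidenceFinset_top_eq, card_star]
    exact hk
  constructor
  · refine expect_nonneg fun v _ => expect_nonneg fun S hS => expect_nonneg fun H hH => ?_
    rw [sub_nonneg]
    split_ifs with h1 h2 <;> norm_num
    exact h2 ((le_maxDegree_iff hn _ _).2 ⟨v, h1⟩)
  · refine expect_le univ_nonempty fun v _ => expect_le (hS1 v) fun S hS => ?_
    rw [incidenceFinset_top_eq, mem_powersetCard] at hS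
    obtain ⟨hSv, hSk⟩ := hS
    have hSE : S ⊆ allEdges n := hSv.trans (star_subset v)
    calc _ ≤ sliceMean (allEdges n \ S) (m - k)
          (fun H => ∑ u : Fin n, hits (starEdges u) (⌈t⌉₊ - 1) H) := by
          rw [sliceMean]
          simp only [edgeFinset_top_eq]
          refine le_trans (le_of_eq ?_) (expect_le_expect (f := fun H =>
            (if t ≤ (maxDegree (SimpleGraph.fromEdgeSet (↑(S ∪ H) : Set (Sym2 (Fin n)))) : ℝ)
              then (1 : ℝ) else 0) -
            (if t ≤ (vertexDegree (SimpleGraph.fromEdgeSet (↑(S ∪ H) : Set (Sym2 (Fin n)))) v : ℝ)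
              then (1 : ℝ) else 0)) fun H hH => ?_)
          · congr!
          have hH := (mem_powersetCard.1 hH).1
          have hSH : S ∪ H ⊆ allEdges n := union_subset hSE (hH.trans sdiff_subset)
          have hnn : 0 ≤ ∑ u : Fin n, hits (starEdges u) (⌈t⌉₊ - 1) H :=
            sum_nonneg fun v _ => hits_nonneg _ _ _
          by_cases hv : t ≤ (vertexDegree
              (SimpleGraph.fromEdgeSet (↑(S ∪ H) : Set (Sym2 (Fin n)))) v : ℝ)
          · rw [if_pos hv]
            refine le_trans ?_ hnn
            split_ifs <;> norm_num
          rw [if_neg hv, sub_zero]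
          split_ifs with h
          · obtain ⟨u, hu⟩ := (le_maxDegree_iff hn _ _).1 h
            have huv : u ≠ v := fun h => hv (h ▸ hu)
            rw [le_vertexDegree_iff hSH, union_inter_distrib_right] at hu
            have h1 : #(S ∩ starEdges u) ≤ 1 := by
              calc #(S ∩ starEdges u) ≤ #(starEdges v ∩ starEdges u) :=
                    card_le_card (inter_subset_inter_right hSv)
                _ = 1 := by rw [star_inter_star huv.symm, card_singleton]
            have h2 := card_union_le (S ∩ starEdges u) (H ∩ starEdges u)
            calc (1 : ℝ) = hits (starEdges u) (⌈t⌉₊ - 1) H := by rw [hits, if_pos (by omega)]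
              _ ≤ _ := single_le_sum (f := fun v => hits (starEdges v) (⌈t⌉₊ - 1) H)
                  (fun v _ => hits_nonneg _ _ _) (Finset.mem_univ u)
          · exact hnn
      _ = ∑ u : Fin n, sliceMean (allEdges n \ S) (m - k) (hits (starEdges u) (⌈t⌉₊ - 1)) :=
          sliceMean_sum _ _ _ _
      _ ≤ ∑ _u : Fin n, degreeTail n m (⌈t⌉₊ - 1) := by
          refine sum_le_sum fun u _ => ?_
          rw [← sliceMean_hits_star u hm]
          have h := sliceMean_sdiff_le hSE (j := m - k) (by rw [card_allEdges]; omega)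
            (hits_monotone (starEdges u) (⌈t⌉₊ - 1))
          rwa [hSk, Nat.sub_add_cancel (hk.trans hm)] at h
      _ = _ := by simp

/-- The second moment method for the number of vertices of degree at least `⌈t⌉`. -/
lemma one_sub_nullProb_le_maxDegree_le (hn : 2 ≤ n) {m : ℕ} (hm : n - 1 ≤ m) {t : ℝ}
    (ht : 0 < t) (hN : 2 * (m + (n - 1)) ≤ n.choose 2) (hq : 0 < degreeTail n m ⌈t⌉₊) :
    1 - nullProb n m (fun G => t ≤ (maxDegree G : ℝ))
      ≤ 1 / (n * degreeTail n m ⌈t⌉₊)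
        + ((m : ℝ) / (n.choose 2 : ℕ) *
            ((⌈t⌉₊ : ℝ) / hypMean (n - 1) (n.choose 2 - (n - 1)) m + 2) ^ 2
          + (1 / (1 - (m : ℝ) / (n.choose 2 : ℕ)) - 1)) := by
  classical
  set q := degreeTail n m ⌈t⌉₊ with hqd
  set J := (m : ℝ) / (n.choose 2 : ℕ) *
            ((⌈t⌉₊ : ℝ) / hypMean (n - 1) (n.choose 2 - (n - 1)) m + 2) ^ 2
          + 1 / (1 - (m : ℝ) / (n.choose 2 : ℕ)) with hJ
  have hpair : ∀ u v : Fin n, u ≠ v →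
      sliceMean (allEdges n) m (fun M => hits (starEdges u) ⌈t⌉₊ M * hits (starEdges v) ⌈t⌉₊ M)
        ≤ J * q ^ 2 := by
    intro u v huv
    obtain ⟨K, hK⟩ : ∃ K, n - 1 = K + 1 := ⟨n - 2, by omega⟩
    obtain ⟨m', rfl⟩ : ∃ m', m = m' + 1 := ⟨m - 1, by omega⟩
    obtain ⟨s, hs⟩ : ∃ s, ⌈t⌉₊ = s + 1 := by
      have := Nat.ceil_pos.2 ht
      exact ⟨⌈t⌉₊ - 1, by omega⟩
    obtain ⟨C, hC⟩ : ∃ C, n.choose 2 = K + 1 + C := ⟨n.choose 2 - (K + 1), by omega⟩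
    have h := sliceMean_hits_mul_hits_le (star_subset u) (star_subset v) (star_inter_star huv)
      (K := K) (C := C) (m := m') (by rw [card_star, hK]) (by rw [card_star, hK])
      (by rw [card_allEdges, hC]) (by omega) (by omega) ?_ s
    · rw [hJ, hqd, degreeTail, hs, hK, show n.choose 2 - (K + 1) = C by omega]
      rw [card_allEdges] at h
      push_cast at h ⊢
      exact h
    · have : ((K + 1 + C + 2 * m' : ℕ) : ℝ) ≤ ((2 * C : ℕ) : ℝ) := by
        exact_mod_cast (by omega)
      push_cast at this
      linarith
  have hmean := fun v : Fin n => sliceMean_hits_star v hm ⌈t⌉₊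
  set X : Finset (Sym2 (Fin n)) → ℝ := fun M => ∑ v : Fin n, hits (starEdges v) ⌈t⌉₊ M with hX
  have hn0 : (0 : ℝ) < n := by exact_mod_cast (by omega : 0 < n)
  have hJ0 : 0 ≤ J * q ^ 2 := by
    have : Fact (1 < n) := ⟨by omega⟩
    refine le_trans ?_ (hpair ⟨0, by omega⟩ ⟨1, by omega⟩ (by simp))
    exact expect_nonneg fun M _ => mul_nonneg (hits_nonneg _ _ _) (hits_nonneg _ _ _)
  have e1 : sliceMean (allEdges n) m X = n * q := by
    rw [hX, sliceMean_sum, sum_congr rfl fun v _ => hmean v]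
    simp [hqd]
  have e2 : sliceMean (allEdges n) m (fun M => X M ^ 2) ≤ n * q + n ^ 2 * (J * q ^ 2) := by
    have : ∀ M, X M ^ 2
        = ∑ u : Fin n, ∑ v : Fin n, hits (starEdges u) ⌈t⌉₊ M * hits (starEdges v) ⌈t⌉₊ M := by
      intro M
      rw [sq, hX, sum_mul_sum]
    simp_rw [this]
    rw [sliceMean_sum]
    simp_rw [sliceMean_sum]
    calc _ ≤ ∑ u : Fin n, ∑ v : Fin n, ((if u = v then q else 0) + J * q ^ 2) := by
          refine sum_le_sum fun u _ => sum_le_sum fun v _ => ?_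
          split_ifs with huv
          · subst huv
            have : ∀ M, hits (starEdges u) ⌈t⌉₊ M * hits (starEdges u) ⌈t⌉₊ M = hits (starEdges u) ⌈t⌉₊ M := by
              intro M; unfold hits; split_ifs <;> norm_num
            rw [sliceMean_congr fun M _ => this M, hmean u]
            linarith
          · rw [zero_add]
            exact hpair u v huv
      _ = _ := by
          simp only [sum_add_distrib, sum_ite_eq, Finset.mem_univ, if_true, sum_const, card_univ,
            Fintype.card_fin, nsmul_eq_mul]
          ring
  have hne : ((allEdges n).powersetCard m).Nonempty := by
    rw [powersetCard_nonempty, card_allEdges]; omega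
  have e3 : sliceMean (allEdges n) m (fun M => (X M - n * q) ^ 2)
      = sliceMean (allEdges n) m (fun M => X M ^ 2) - (n * q) ^ 2 := by
    have h : ∀ M, (X M - n * q) ^ 2 = X M ^ 2 - (2 * (n * q)) * X M + (n * q) ^ 2 :=
      fun M => by ring
    have e1' : 𝔼 M ∈ (allEdges n).powersetCard m, X M = n * q := e1
    simp_rw [h, sliceMean]
    rw [expect_add_distrib, expect_sub_distrib, expect_const hne, ← mul_expect, e1']
    ring
  have e4 : 1 - nullProb n m (fun G => t ≤ (maxDegree G : ℝ))
      ≤ sliceMean (allEdges n) m (fun M => (X M - n * q) ^ 2) / (n * q) ^ 2 := by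
    have hpos : 0 < n * q := mul_pos hn0 hq
    rw [nullProb_eq_sliceMean, sliceMean, sliceMean]
    nth_rewrite 1 [← expect_const hne (1 : ℝ)]
    rw [← expect_sub_distrib, expect_div]
    refine expect_le_expect fun M hM => ?_
    have hM := (mem_powersetCard.1 hM).1
    split_ifs with h
    · rw [sub_self]; positivity
    · have : X M = 0 := by
        refine sum_eq_zero fun v _ => ?_
        rw [hits, if_neg]
        intro hv
        exact h ((le_maxDegree_iff (by omega) _ _).2 ⟨v, (le_vertexDegree_iff hM v t).2 hv⟩)
      rw [this, zero_sub, neg_sq, sub_zero, div_self (by positivity)]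
  refine e4.trans ?_
  have hpos : 0 < n * q := mul_pos hn0 hq
  rw [e3, div_le_iff₀ (by positivity)]
  have : (1 / (n * q) + (((m : ℝ) / (n.choose 2 : ℕ) *
            ((⌈t⌉₊ : ℝ) / hypMean (n - 1) (n.choose 2 - (n - 1)) m + 2) ^ 2
          + (1 / (1 - (m : ℝ) / (n.choose 2 : ℕ)) - 1)))) * (n * q) ^ 2
      = n * q + n ^ 2 * (J * q ^ 2) - (n * q) ^ 2 := by
    rw [hJ]
    generalize 1 / (1 - (m : ℝ) / (n.choose 2 : ℕ)) = w
    field_simp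
    ring
  rw [this]
  linarith

end Graphs

/-! ### Asymptotics of the degree tail at the threshold -/

section Asymptotic

/-- The number `x` of standard deviations by which the threshold exceeds the mean degree. -/
noncomputable def deviation (α : ℝ) (n : ℕ) : ℝ :=
  √(2 * Real.log n - 1 / α * Real.log (Real.log n))

/-- Inequalities which hold for all large `n` in the regime `n (log n)³ ≪ m ≪ n²`, and which
suffice for the Gaussian bounds on the degree tail at the threshold. -/
structure InRange (α : ℝ) (n m : ℕ) : Prop where
  alpha_pos : 0 < α
  le_n : 16 ≤ n
  le_log : 4 ≤ Real.log n
  log_le : 8 * Real.log n ≤ n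
  loglog_le : Real.log (Real.log n) ≤ α * Real.log n
  le_m : 8 * (n * Real.log n ^ 3) ≤ m
  m_le : 100 * (m : ℝ) ≤ (n : ℝ) ^ 2

lemma eventually_inRange {α : ℝ} (hα : 0 < α) {m : ℕ → ℕ} (hm : EdgeCountRegime m) :
    ∀ᶠ n in atTop, InRange α n (m n) := by
  have hlog : Tendsto (fun n : ℕ => Real.log n) atTop atTop :=
    Real.tendsto_log_atTop.comp tendsto_natCast_atTop_atTop
  have h1 := hlog.eventually_ge_atTop 4
  have h2 : ∀ᶠ n : ℕ in atTop, ‖Real.log n‖ ≤ 1 / 8 * ‖(n : ℝ)‖ :=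
    tendsto_natCast_atTop_atTop.eventually
      (Real.isLittleO_log_id_atTop.bound (by norm_num : (0 : ℝ) < 1 / 8))
  have h3 : ∀ᶠ n : ℕ in atTop, ‖Real.log (Real.log n)‖ ≤ α * ‖Real.log n‖ :=
    hlog.eventually (Real.isLittleO_log_id_atTop.bound hα)
  have h4 := hm.1.bound (by norm_num : (0 : ℝ) < 1 / 8)
  have h5 := hm.2.bound (by norm_num : (0 : ℝ) < 1 / 100)
  filter_upwards [h1, h2, h3, h4, h5, eventually_ge_atTop 16] with n h1 h2 h3 h4 h5 h6
  rw [Real.norm_of_nonneg (by positivity), Real.norm_of_nonneg (by positivity)] at h2 h4 h5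
  rw [Real.norm_of_nonneg (by linarith : 0 ≤ Real.log n)] at h3
  have h3' := (Real.le_norm_self _).trans h3
  exact ⟨hα, h6, h1, by linarith, h3', by linarith, by linarith⟩

namespace InRange

variable {α : ℝ} {n m : ℕ}

lemma sub_one_le_choose (h : InRange α n m) : n - 1 ≤ n.choose 2 := by
  have : ((n - 1 : ℕ) : ℝ) ≤ (n.choose 2 : ℕ) := by
    have hn : (16 : ℝ) ≤ n := by exact_mod_cast h.le_n
    rw [Nat.cast_choose_two, Nat.cast_sub (by have := h.le_n; omega)]
    push_cast
    nlinarith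
  exact_mod_cast this

lemma le_cast (h : InRange α n m) : 512 * (n : ℝ) ≤ m := by
  have hn : (16 : ℝ) ≤ n := by exact_mod_cast h.le_n
  have h3 : (4 : ℝ) ^ 3 ≤ Real.log n ^ 3 := pow_le_pow_left₀ (by norm_num) h.le_log 3
  have := mul_le_mul_of_nonneg_left h3 (by linarith : (0 : ℝ) ≤ n)
  linarith [h.le_m]

lemma sub_one_le (h : InRange α n m) : n - 1 ≤ m := by
  have h1 := h.le_cast
  have : (n : ℝ) ≤ m := by
    have : (0 : ℝ) ≤ n := by positivity
    linarith
  have : n ≤ m := by exact_mod_cast this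
  omega

lemma eight_mul_le_choose (h : InRange α n m) : 8 * (m + (n - 1)) ≤ n.choose 2 := by
  have hn : (16 : ℝ) ≤ n := by exact_mod_cast h.le_n
  have : ((8 * (m + n) : ℕ) : ℝ) ≤ (n.choose 2 : ℕ) := by
    rw [Nat.cast_choose_two]
    push_cast
    have := h.le_cast
    have := h.m_le
    nlinarith
  have : 8 * (m + n) ≤ n.choose 2 := by exact_mod_cast this
  omega

lemma density_le (h : InRange α n m) : (m : ℝ) / (n.choose 2 : ℕ) ≤ 1 / 8 := by
  have h1 : ((8 * (m + (n - 1)) : ℕ) : ℝ) ≤ (n.choose 2 : ℕ) := by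
    exact_mod_cast h.eight_mul_le_choose
  have h2 : (0 : ℝ) ≤ (n - 1 : ℕ) := by positivity
  have h3 : (0 : ℝ) < m := by
    have hn : (16 : ℝ) ≤ n := by exact_mod_cast h.le_n
    linarith [h.le_cast]
  push_cast at h1
  rw [div_le_iff₀ (by linarith)]
  linarith

lemma add_eq (h : InRange α n m) :
    ((n - 1 : ℕ) : ℝ) + ((n.choose 2 - (n - 1) : ℕ) : ℝ) = (n.choose 2 : ℕ) := by
  rw [← Nat.cast_add, Nat.add_sub_cancel' h.sub_one_le_choose]

lemma mean_eq (h : InRange α n m) :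
    hypMean (n - 1) (n.choose 2 - (n - 1)) m = 2 * (m : ℝ) / n := by
  have hn : (16 : ℝ) ≤ n := by exact_mod_cast h.le_n
  rw [hypMean, h.add_eq, Nat.cast_choose_two, Nat.cast_sub (by have := h.le_n; omega)]
  have : (0 : ℝ) < (n : ℝ) - 1 := by linarith
  push_cast
  field_simp

lemma var_eq (h : InRange α n m) :
    binVar (n - 1) (n.choose 2 - (n - 1)) m
      = 2 * (m : ℝ) / n * (1 - (m : ℝ) / (n.choose 2 : ℕ)) := by
  rw [binVar, h.mean_eq, h.add_eq]

lemma var_ge (h : InRange α n m) : (m : ℝ) / n ≤ binVar (n - 1) (n.choose 2 - (n - 1)) m := by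
  rw [h.var_eq]
  have h1 := h.density_le
  have h2 : 0 ≤ (m : ℝ) / n := by positivity
  rw [mul_div_assoc]
  nlinarith

lemma threshold_eq (h : InRange α n m) :
    degreeThreshold α n m = hypMean (n - 1) (n.choose 2 - (n - 1)) m
      + √(binVar (n - 1) (n.choose 2 - (n - 1)) m) * deviation α n := by
  rw [degreeThreshold, h.mean_eq, h.var_eq, deviation]

lemma deviation_sq (h : InRange α n m) :
    deviation α n ^ 2 = 2 * Real.log n - 1 / α * Real.log (Real.log n) := by
  refine Real.sq_sqrt ?_
  have : 1 / α * Real.log (Real.log n) ≤ Real.log n := by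
    rw [div_mul_eq_mul_div, one_mul, div_le_iff₀ h.alpha_pos]
    linarith [h.loglog_le]
  linarith [h.le_log]

lemma log_le_deviation_sq (h : InRange α n m) : Real.log n ≤ deviation α n ^ 2 := by
  have : 1 / α * Real.log (Real.log n) ≤ Real.log n := by
    rw [div_mul_eq_mul_div, one_mul, div_le_iff₀ h.alpha_pos]
    linarith [h.loglog_le]
  rw [h.deviation_sq]
  linarith

lemma deviation_sq_le (h : InRange α n m) : deviation α n ^ 2 ≤ 2 * Real.log n := by
  rw [h.deviation_sq]
  have := Real.log_nonneg (by linarith [h.le_log] : 1 ≤ Real.log n)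
  have := mul_nonneg (one_div_nonneg.2 h.alpha_pos.le) this
  linarith

lemma two_le_deviation (h : InRange α n m) : 2 ≤ deviation α n := by
  refine Real.le_sqrt_of_sq_le ?_
  rw [← h.deviation_sq]
  linarith [h.log_le_deviation_sq, h.le_log]

lemma deviation_cube_le (h : InRange α n m) :
    deviation α n ^ 3 ≤ √(binVar (n - 1) (n.choose 2 - (n - 1)) m) := by
  refine Real.le_sqrt_of_sq_le (le_trans ?_ h.var_ge)
  have hn : (16 : ℝ) ≤ n := by exact_mod_cast h.le_n
  calc (deviation α n ^ 3) ^ 2 = (deviation α n ^ 2) ^ 3 := by ring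
    _ ≤ (2 * Real.log n) ^ 3 := pow_le_pow_left₀ (sq_nonneg _) h.deviation_sq_le 3
    _ = 8 * Real.log n ^ 3 := by ring
    _ ≤ (m : ℝ) / n := by
        rw [le_div_iff₀ (by linarith)]
        linarith [h.le_m]

lemma exp_deviation (h : InRange α n m) :
    n * Real.exp (-(deviation α n ^ 2 / 2)) = Real.exp (Real.log (Real.log n) / (2 * α)) := by
  have hn : (16 : ℝ) ≤ n := by exact_mod_cast h.le_n
  have hα := h.alpha_pos
  rw [h.deviation_sq]
  nth_rewrite 1 [← Real.exp_log (by linarith : (0 : ℝ) < n)]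
  rw [← Real.exp_add]
  congr 1
  field_simp
  ring

lemma sqrt_log (h : InRange α n m) : √(Real.log n) = Real.exp (Real.log (Real.log n) / 2) := by
  rw [Real.sqrt_eq_iff_mul_self_eq (by linarith [h.le_log]) (Real.exp_pos _).le, ← Real.exp_add,
    add_halves, Real.exp_log (by linarith [h.le_log])]

lemma one_le_sqrt_var (h : InRange α n m) :
    1 ≤ √(binVar (n - 1) (n.choose 2 - (n - 1)) m) := by
  have := h.deviation_cube_le
  have := one_le_pow₀ (n := 3) (by linarith [h.two_le_deviation] : 1 ≤ deviation α n)
  linarith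

lemma threshold_gt (h : InRange α n m) : 1 < degreeThreshold α n m := by
  rw [h.threshold_eq]
  have h1 := h.one_le_sqrt_var
  have h2 := h.two_le_deviation
  have h3 := hypMean_pos (B := n.choose 2 - (n - 1)) (by have := h.le_n; omega) h.sub_one_le
  nlinarith

/-- The expected number of vertices of degree at least `⌈t⌉ - 1` is at most of the order of
`(log n) ^ (1 / (2 α) - 1 / 2)`. -/
lemma mul_degreeTail_le (h : InRange α n m) :
    n * degreeTail n m (⌈degreeThreshold α n m⌉₊ - 1)
      ≤ 5 * Real.exp 3 * Real.exp (-((1 / 2 - 1 / (2 * α)) * Real.log (Real.log n))) := by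
  have hn := h.le_n
  have ht := h.threshold_gt
  have hV := binVar_pos (B := n.choose 2 - (n - 1)) (by omega) h.sub_one_le
    (by have := h.eight_mul_le_choose; omega)
  have hp : hypMean (n - 1) (n.choose 2 - (n - 1)) m
      ≤ 2 * binVar (n - 1) (n.choose 2 - (n - 1)) m := by
    have := h.var_ge
    rw [h.mean_eq, mul_div_assoc]; linarith
  have hs : ((⌈degreeThreshold α n m⌉₊ - 1 : ℕ) : ℝ) = ⌈degreeThreshold α n m⌉₊ - 1 := by
    rw [Nat.cast_sub (Nat.one_le_ceil_iff.2 (by linarith)), Nat.cast_one]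
  have c1 := Nat.le_ceil (degreeThreshold α n m)
  have c2 := Nat.ceil_lt_add_one (a := degreeThreshold α n m) (by linarith)
  have key := hypTail_le (K := n - 1) (B := n.choose 2 - (n - 1)) (m := m) (by omega)
    h.sub_one_le (by have := h.eight_mul_le_choose; omega) hp
    (σ := √(binVar (n - 1) (n.choose 2 - (n - 1)) m)) (x := deviation α n)
    (Real.sq_sqrt hV.le) h.two_le_deviation h.deviation_cube_le
    (s := ⌈degreeThreshold α n m⌉₊ - 1)
    (by rw [hs]; linarith [h.threshold_eq]) (by rw [hs]; linarith [h.threshold_eq])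
  have hx : Real.exp (Real.log (Real.log n) / 2) ≤ deviation α n := by
    rw [← h.sqrt_log]
    exact Real.sqrt_le_iff.2 ⟨by linarith [h.two_le_deviation], h.log_le_deviation_sq⟩
  have hx0 : 0 < deviation α n := by linarith [h.two_le_deviation]
  calc n * degreeTail n m (⌈degreeThreshold α n m⌉₊ - 1)
      ≤ n * (5 * Real.exp 3 * (Real.exp (-(deviation α n ^ 2 / 2)) / deviation α n)) :=
        mul_le_mul_of_nonneg_left key (by positivity)
    _ = 5 * Real.exp 3 * ((n * Real.exp (-(deviation α n ^ 2 / 2))) / deviation α n) := by ring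
    _ = 5 * Real.exp 3 * (Real.exp (Real.log (Real.log n) / (2 * α)) / deviation α n) := by
        rw [h.exp_deviation]
    _ ≤ 5 * Real.exp 3 * (Real.exp (Real.log (Real.log n) / (2 * α))
          / Real.exp (Real.log (Real.log n) / 2)) := by gcongr
    _ = _ := by
        rw [← Real.exp_sub]
        congr 2
        have := h.alpha_pos
        field_simp
        ring

/-- The expected number of vertices of degree at least `⌈t⌉` is at least of the order of
`(log n) ^ (1 / (2 α) - 1 / 2)`. -/
lemma le_mul_degreeTail (h : InRange α n m) :
    Real.exp (-91) / 16 * Real.exp ((1 / (2 * α) - 1 / 2) * Real.log (Real.log n))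
      ≤ n * degreeTail n m ⌈degreeThreshold α n m⌉₊ := by
  have hn := h.le_n
  have hn' : (16 : ℝ) ≤ n := by exact_mod_cast h.le_n
  have ht := h.threshold_gt
  have hmC : m ≤ n.choose 2 - (n - 1) := by have := h.eight_mul_le_choose; omega
  have hV := binVar_pos (B := n.choose 2 - (n - 1)) (by omega) h.sub_one_le hmC
  have hVμ := binVar_le_mean (B := n.choose 2 - (n - 1)) (by omega) h.sub_one_le
  have c1 := Nat.le_ceil (degreeThreshold α n m)
  have c2 := Nat.ceil_lt_add_one (a := degreeThreshold α n m) (by linarith)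
  have hm0 : (0 : ℝ) ≤ m := by positivity
  have hD : (n : ℝ) / 4 * binVar (n - 1) (n.choose 2 - (n - 1)) m ≤ m / 2 := by
    calc _ ≤ (n : ℝ) / 4 * (2 * (m : ℝ) / n) := by
          rw [h.mean_eq] at hVμ
          exact mul_le_mul_of_nonneg_left hVμ (by positivity)
      _ = m / 2 := by field_simp; norm_num
  have hmean : hypMean (n - 1) (n.choose 2 - (n - 1)) m ≤ m / 2 := by
    rw [h.mean_eq, div_le_div_iff₀ (by linarith) (by norm_num)]
    nlinarith
  have hmean0 := hypMean_pos (B := n.choose 2 - (n - 1)) (by omega) h.sub_one_le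
  have hC : 2 * (m : ℝ) ≤ ((n.choose 2 - (n - 1) : ℕ) : ℝ) := by
    have : 2 * m ≤ n.choose 2 - (n - 1) := by have := h.eight_mul_le_choose; omega
    exact_mod_cast this
  have key := le_hypTail (K := n - 1) (B := n.choose 2 - (n - 1)) (m := m) (by omega)
    h.sub_one_le hmC
    (σ := √(binVar (n - 1) (n.choose 2 - (n - 1)) m)) (x := deviation α n) (ρ := (n : ℝ) / 4)
    (Real.sq_sqrt hV.le) h.two_le_deviation h.deviation_cube_le (by linarith)
    (by linarith [h.deviation_sq_le, h.log_le]) (by linarith) (by linarith)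
    (s := ⌈degreeThreshold α n m⌉₊)
    (by linarith [h.threshold_eq]) (by linarith [h.threshold_eq])
  have hx0 : 0 < deviation α n := by linarith [h.two_le_deviation]
  have hx : deviation α n ≤ 2 * Real.exp (Real.log (Real.log n) / 2) := by
    rw [← h.sqrt_log]
    refine abs_le_of_sq_le_sq' ?_ (by positivity) |>.2
    rw [mul_pow, Real.sq_sqrt (by linarith [h.le_log])]
    linarith [h.deviation_sq_le, h.le_log]
  calc _ = Real.exp (-91) / 8 * (Real.exp (Real.log (Real.log n) / (2 * α))
          / (2 * Real.exp (Real.log (Real.log n) / 2))) := by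
        have : (1 / (2 * α) - 1 / 2) * Real.log (Real.log n)
            = Real.log (Real.log n) / (2 * α) - Real.log (Real.log n) / 2 := by ring
        rw [this, Real.exp_sub]
        ring
    _ ≤ Real.exp (-91) / 8 * (Real.exp (Real.log (Real.log n) / (2 * α)) / deviation α n) := by
        gcongr
    _ = n * (Real.exp (-91) / 8 * (Real.exp (-(deviation α n ^ 2 / 2)) / deviation α n)) := by
        rw [← h.exp_deviation]; ring
    _ ≤ _ := mul_le_mul_of_nonneg_left key (by positivity)

lemma ceil_div_mean_le (h : InRange α n m) :
    (⌈degreeThreshold α n m⌉₊ : ℝ) / hypMean (n - 1) (n.choose 2 - (n - 1)) m + 2 ≤ 5 := by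
  have hn := h.le_n
  have hm0 := hypMean_pos (B := n.choose 2 - (n - 1)) (by omega) h.sub_one_le
  have hVμ := binVar_le_mean (B := n.choose 2 - (n - 1)) (by omega) h.sub_one_le
  have ht := h.threshold_gt
  have c2 := Nat.ceil_lt_add_one (a := degreeThreshold α n m) (by linarith)
  rw [h.threshold_eq] at c2 ⊢
  have s1 := h.one_le_sqrt_var
  have s2 := h.two_le_deviation
  have s3 := h.deviation_cube_le
  have s4 : √(binVar (n - 1) (n.choose 2 - (n - 1)) m) ^ 2
      = binVar (n - 1) (n.choose 2 - (n - 1)) m := by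
    refine Real.sq_sqrt ?_
    exact le_trans (by positivity) h.var_ge
  have s5 : deviation α n ≤ deviation α n ^ 3 := le_self_pow₀ (by linarith) (by norm_num)
  have s6 : √(binVar (n - 1) (n.choose 2 - (n - 1)) m) * deviation α n
      ≤ hypMean (n - 1) (n.choose 2 - (n - 1)) m := by
    nlinarith
  have s7 : 1 ≤ hypMean (n - 1) (n.choose 2 - (n - 1)) m := by nlinarith
  have : (⌈hypMean (n - 1) (n.choose 2 - (n - 1)) m
      + √(binVar (n - 1) (n.choose 2 - (n - 1)) m) * deviation α n⌉₊ : ℝ)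
        / hypMean (n - 1) (n.choose 2 - (n - 1)) m ≤ 3 := by
    rw [div_le_iff₀ hm0]; linarith
  linarith

end InRange

lemma tendsto_loglog : Tendsto (fun n : ℕ => Real.log (Real.log n)) atTop atTop :=
  Real.tendsto_log_atTop.comp (Real.tendsto_log_atTop.comp tendsto_natCast_atTop_atTop)

lemma tendsto_density {m : ℕ → ℕ} (hm : EdgeCountRegime m) :
    Tendsto (fun n : ℕ => (m n : ℝ) / (n.choose 2 : ℕ)) atTop (𝓝 0) := by
  have h0 := (hm.2.tendsto_div_nhds_zero).mul_const (4 : ℝ)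
  rw [zero_mul] at h0
  refine squeeze_zero' (Eventually.of_forall fun n => by positivity) ?_ h0
  filter_upwards [eventually_ge_atTop 2] with n hn
  have hn' : (2 : ℝ) ≤ n := by exact_mod_cast hn
  rw [Nat.cast_choose_two, div_mul_eq_mul_div, div_le_div_iff₀ (by nlinarith) (by positivity)]
  have : (0 : ℝ) ≤ m n := by positivity
  have h2 : (n : ℝ) ^ 2 ≤ 4 * (n * ((n : ℝ) - 1) / 2) := by nlinarith
  nlinarith

lemma tendsto_mul_degreeTail {α : ℝ} (hα : 1 < α) {m : ℕ → ℕ} (hm : EdgeCountRegime m) :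
    Tendsto (fun n : ℕ => (n : ℝ) * degreeTail n (m n) (⌈degreeThreshold α n (m n)⌉₊ - 1))
      atTop (𝓝 0) := by
  have hc : 0 < 1 / 2 - 1 / (2 * α) := by
    rw [sub_pos]
    exact one_div_lt_one_div_of_lt (by norm_num) (by linarith)
  have h0 : Tendsto (fun n : ℕ =>
      5 * Real.exp 3 * Real.exp (-((1 / 2 - 1 / (2 * α)) * Real.log (Real.log n))))
      atTop (𝓝 (5 * Real.exp 3 * 0)) :=
    (Real.tendsto_exp_neg_atTop_nhds_zero.comp (tendsto_loglog.const_mul_atTop hc)).const_mul _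
  rw [mul_zero] at h0
  refine squeeze_zero' (Eventually.of_forall fun n => ?_) ?_ h0
  · exact mul_nonneg (by positivity) (hypTail_nonneg _ _ _ _)
  · filter_upwards [eventually_inRange (zero_lt_one.trans hα) hm] with n hn
    exact hn.mul_degreeTail_le

lemma tendsto_nullProb_zero {α : ℝ} (hα : 1 < α) {m : ℕ → ℕ} (hm : EdgeCountRegime m) :
    Tendsto (fun n : ℕ =>
      nullProb n (m n) (fun G => degreeThreshold α n (m n) ≤ (maxDegree G : ℝ)))
      atTop (𝓝 0) := by
  refine squeeze_zero' (Eventually.of_forall fun n => nullProb_nonneg _ _ _) ?_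
    (tendsto_mul_degreeTail hα hm)
  filter_upwards [eventually_inRange (zero_lt_one.trans hα) hm] with n hn
  have h16 := hn.le_n
  refine (nullProb_le_maxDegree_le (by omega) hn.sub_one_le _).trans ?_
  exact mul_le_mul_of_nonneg_left (degreeTail_antitone _ _ (Nat.sub_le _ _)) (by positivity)

lemma tendsto_nullProb_one {α : ℝ} (hα0 : 0 < α) (hα : α < 1) {m : ℕ → ℕ}
    (hm : EdgeCountRegime m) :
    Tendsto (fun n : ℕ =>
      nullProb n (m n) (fun G => degreeThreshold α n (m n) ≤ (maxDegree G : ℝ)))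
      atTop (𝓝 1) := by
  have hc : 0 < 1 / (2 * α) - 1 / 2 := by
    rw [sub_pos]
    exact one_div_lt_one_div_of_lt (by linarith) (by linarith)
  have hlow : Tendsto (fun n : ℕ =>
      Real.exp (-91) / 16 * Real.exp ((1 / (2 * α) - 1 / 2) * Real.log (Real.log n)))
      atTop atTop :=
    (Real.tendsto_exp_atTop.comp (tendsto_loglog.const_mul_atTop hc)).const_mul_atTop
      (by positivity)
  have hmean : Tendsto (fun n : ℕ =>
      (n : ℝ) * degreeTail n (m n) ⌈degreeThreshold α n (m n)⌉₊) atTop atTop := by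
    refine tendsto_atTop_mono' _ ?_ hlow
    filter_upwards [eventually_inRange hα0 hm] with n hn
    exact hn.le_mul_degreeTail
  have hp := tendsto_density hm
  have herr : Tendsto (fun n : ℕ =>
      1 - (1 / ((n : ℝ) * degreeTail n (m n) ⌈degreeThreshold α n (m n)⌉₊)
        + ((m n : ℝ) / (n.choose 2 : ℕ) * 25
          + (1 / (1 - (m n : ℝ) / (n.choose 2 : ℕ)) - 1)))) atTop
      (𝓝 (1 - (0 + (0 * 25 + (1 / (1 - 0) - 1))))) := by
    refine (Tendsto.add ?_ ((hp.mul_const 25).add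
      (((tendsto_const_nhds.div (tendsto_const_nhds.sub hp) (by norm_num)).sub_const
        1)))).const_sub 1
    simp only [one_div]
    exact hmean.inv_tendsto_atTop
  rw [show (1 - (0 + (0 * 25 + (1 / (1 - 0) - 1))) : ℝ) = 1 by norm_num] at herr
  refine tendsto_of_tendsto_of_tendsto_of_le_of_le' herr tendsto_const_nhds ?_ ?_
  · filter_upwards [eventually_inRange hα0 hm, hmean.eventually_gt_atTop 0] with n hn hpos
    have h16 := hn.le_n
    have hchoose := hn.eight_mul_le_choose
    have hq := pos_of_mul_pos_right hpos (by positivity : (0 : ℝ) ≤ n)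
    have key := one_sub_nullProb_le_maxDegree_le (n := n) (m := m n) (by omega) hn.sub_one_le
      (by linarith [hn.threshold_gt]) (by omega) hq
    have hm0 := hypMean_pos (B := n.choose 2 - (n - 1)) (by omega) hn.sub_one_le
    have h5 : ((⌈degreeThreshold α n (m n)⌉₊ : ℝ)
        / hypMean (n - 1) (n.choose 2 - (n - 1)) (m n) + 2) ^ 2 ≤ 25 := by
      calc _ ≤ (5 : ℝ) ^ 2 := pow_le_pow_left₀ (by positivity) hn.ceil_div_mean_le 2
        _ = 25 := by norm_num
    have h6 := mul_le_mul_of_nonneg_left h5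
      (by positivity : (0 : ℝ) ≤ (m n : ℝ) / (n.choose 2 : ℕ))
    linarith
  · filter_upwards [eventually_inRange hα0 hm] with n hn
    have hchoose := hn.eight_mul_le_choose
    exact nullProb_le_one _ _ (by omega) _

lemma tendsto_plantedProb_sub {α : ℝ} (hα : 1 < α) {m k : ℕ → ℕ} (hm : EdgeCountRegime m)
    (hk : StarSizeRegime k) :
    Tendsto (fun n : ℕ =>
      plantedProb n (m n) (k n) (fun _ G => degreeThreshold α n (m n) ≤ (maxDegree G : ℝ))
        - plantedProb n (m n) (k n)
          (fun v G => degreeThreshold α n (m n) ≤ (vertexDegree G v : ℝ)))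
      atTop (𝓝 0) := by
  have hkn : ∀ᶠ n : ℕ in atTop, k n ≤ n - 1 := by
    filter_upwards [hk.2.bound (by norm_num : (0 : ℝ) < 1 / 2), eventually_ge_atTop 2]
      with n h hn
    rw [Real.norm_of_nonneg (by positivity), Real.norm_of_nonneg (by positivity)] at h
    have hn' : (2 : ℝ) ≤ n := by exact_mod_cast hn
    have h1 : √(n : ℝ) ≤ n := Real.sqrt_le_iff.2 ⟨by positivity, by nlinarith⟩
    have h2 : (k n : ℝ) ≤ ((n - 1 : ℕ) : ℝ) := by
      rw [Nat.cast_sub (by omega), Nat.cast_one]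
      linarith
    exact_mod_cast h2
  have hmem : ∀ᶠ n : ℕ in atTop,
      plantedProb n (m n) (k n) (fun _ G => degreeThreshold α n (m n) ≤ (maxDegree G : ℝ))
        - plantedProb n (m n) (k n)
          (fun v G => degreeThreshold α n (m n) ≤ (vertexDegree G v : ℝ))
      ∈ Set.Icc 0 ((n : ℝ) * degreeTail n (m n) (⌈degreeThreshold α n (m n)⌉₊ - 1)) := by
    filter_upwards [eventually_inRange (zero_lt_one.trans hα) hm, hkn] with n hn hkn
    have h16 := hn.le_n
    have hchoose := hn.eight_mul_le_choose
    exact plantedProb_sub_mem (by omega) hn.sub_one_le (by omega) hkn _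
  exact squeeze_zero' (hmem.mono fun n h => h.1) (hmem.mono fun n h => h.2)
    (tendsto_mul_degreeTail hα hm)

end Asymptotic

theorem mainTheorem5 :
    (∀ (α : ℝ) (m k : ℕ → ℕ), 1 < α → EdgeCountRegime m → StarSizeRegime k →
      Tendsto (fun n : ℕ =>
          nullProb n (m n) (fun G => degreeThreshold α n (m n) ≤ (maxDegree G : ℝ)))
        atTop (𝓝 0) ∧
      Tendsto (fun n : ℕ =>
          plantedProb n (m n) (k n)
              (fun _ G => degreeThreshold α n (m n) ≤ (maxDegree G : ℝ))
            - plantedProb n (m n) (k n)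
              (fun v G => degreeThreshold α n (m n) ≤ (vertexDegree G v : ℝ)))
        atTop (𝓝 0)) ∧
    (∀ (α : ℝ) (m : ℕ → ℕ), EdgeCountRegime m →
      (1 < α →
        Tendsto (fun n : ℕ =>
            nullProb n (m n) (fun G => degreeThreshold α n (m n) ≤ (maxDegree G : ℝ)))
          atTop (𝓝 0)) ∧
      (0 < α → α < 1 →
        Tendsto (fun n : ℕ =>
            nullProb n (m n) (fun G => degreeThreshold α n (m n) ≤ (maxDegree G : ℝ)))
          atTop (𝓝 1))) :=
  ⟨fun _ _ _ hα hm hk => ⟨tendsto_nullProb_zero hα hm, tendsto_plantedProb_sub hα hm hk⟩,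
    fun _ _ hm => ⟨fun hα => tendsto_nullProb_zero hα hm,
      fun h0 h1 => tendsto_nullProb_one h0 h1 hm⟩⟩
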